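/- Let $X$ be a complex manifold of dimension $m$ and let $(X,\Omega,\mathcal H)$ be a holomorphic Hamiltonian system: $\Omega$ is a closed holomorphic $2$-form on $X$ that is non-degenerate on the holomorphic tangent bundle $T^{(1,0)}X$, and $\mathcal H:X\to\mathbb C$ is holomorphic. For a holomorphic function $F$ on an open subset of $X$, let $X_F$ be its Hamiltonian vector field, the section of $T^{(1,0)}X$ with $\Omega(X_F,\cdot)=-dF$, and put $\{F,G\}:=\Omega(X_F,X_G)$. Wedge products of $1$-forms are normalized by $(\alpha\wedge\beta)(v,w)=\alpha(v)\beta(w)-\alpha(w)\beta(v)$. Let $x_0\in X$ be a point with $d\mathcal H|_{x_0}\neq 0$. Then $m=2n$ for some $n\ge 1$, and: 1. There is a holomorphic chart $\phi=(z_1,\dots,z_{2n}):U\to V\subset\mathbb C^{2n}$ of $X$ with $x_0\in U$ such that $$\Omega|_U=\sum_{j=1}^n dz_{j+n}\wedge dz_j\quad\text{and}\quad \mathcal H|_U=z_{2n}.$$ 2. There are an open neighborhood $U$ of $x_0$ and holomorphic functions $F_1,\dots,F_n,G_1,\dots,G_n:U\to\mathbb C$ such that on $U$ $$F_n=\mathcal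 H|_U,\qquad \{F_i,G_j\}=\delta_{ij},\qquad \{F_i,F_j\}=\{G_i,G_j\}=0\qquad\text{for all } i,j\in\{1,\dots,n\}.$$ In particular, if $(X,\Omega,\mathcal H)$ is regular, i.e. $d\mathcal H$ vanishes nowhere on $X$, then it is locally integrable as a Hamiltonian system: $m$ is even (if $X\ne\emptyset$) and, with $m=2n$, every point of $X$ has an open neighborhood $U$ with holomorphic functions $F_1,\dots,F_n:U\to\mathbb C$ that Poisson-commute pairwise, have linearly independent differentials at every point of $U$, and satisfy $F_n=\mathcal H|_U$. -/

import Mathlib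

open scoped Manifold ContDiff

noncomputable section

namespace HolHam

/-- The complex coordinate space `ℂ^m`. -/
abbrev Cspace (m : ℕ) : Type := EuclideanSpace ℂ (Fin m)

section Basic

variable {m : ℕ} {X : Type*} [TopologicalSpace X] [ChartedSpace (Cspace m) X]

/-- The differential `df` at `x` of a function `f : X → ℂ`, a `ℂ`-linear form on the
holomorphic tangent space of `X` at `x` (the fibre of `T^{(1,0)}X`, which is the tangent space of
`X` as a manifold over `ℂ`). -/
def differential (f : X → ℂ) (x : X) : TangentSpace 𝓘(ℂ, Cspace m) x →L[ℂ] ℂ :=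
  mfderiv 𝓘(ℂ, Cspace m) 𝓘(ℂ, ℂ) f x

/-- The wedge product `α ∧ β` of two linear forms, `(α ∧ β)(v, w) = α(v) β(w) - α(w) β(v)`. -/
def wedge {V : Type*} [AddCommGroup V] [Module ℂ V] [TopologicalSpace V]
    (α β : V →L[ℂ] ℂ) (v w : V) : ℂ :=
  α v * β w - α w * β v

variable (m X) in
/-- A `2`-form of type `(2,0)` on `X`, without any regularity: an alternating `ℂ`-bilinear form
on every holomorphic tangent space. -/
abbrev TwoForm : Type _ :=
  (x : X) → TangentSpace 𝓘(ℂ, Cspace m) x [⋀^Fin 2]→L[ℂ] ℂ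

/-- The expression of a `2`-form in a chart `φ`: its pullback along `φ⁻¹`, a `2`-form on the
open set `φ.target` of `ℂ^m` (only its values there matter). -/
def TwoForm.inChart (Ω : TwoForm m X) (φ : OpenPartialHomeomorph X (Cspace m)) :
    Cspace m → Cspace m [⋀^Fin 2]→L[ℂ] ℂ := fun z =>
  (Ω (φ.symm z)).compContinuousLinearMap
    (mfderiv 𝓘(ℂ, Cspace m) 𝓘(ℂ, Cspace m) φ.symm z :
      Cspace m →L[ℂ] TangentSpace 𝓘(ℂ, Cspace m) (φ.symm z))

/-- `(X, Ω)` is a holomorphic symplectic manifold: `Ω` is a closed holomorphic `2`-form which is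
non-degenerate on the holomorphic tangent bundle. (Over `ℂ`, the order of smoothness `ω` means
complex analytic, i.e. holomorphic.) -/
structure IsHolomorphicSymplectic (Ω : TwoForm m X) : Prop where
  holomorphic : ∀ φ ∈ atlas (Cspace m) X, ContDiffOn ℂ ω (Ω.inChart φ) φ.target
  closed : ∀ φ ∈ atlas (Cspace m) X, ∀ z ∈ φ.target, extDeriv (Ω.inChart φ) z = 0
  nondegenerate : ∀ (x : X) (v : TangentSpace 𝓘(ℂ, Cspace m) x), v ≠ 0 →
    ∃ w : TangentSpace 𝓘(ℂ, Cspace m) x, Ω x ![v, w] ≠ 0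

/-- `(X, Ω, H)` is a holomorphic Hamiltonian system. -/
structure IsHolomorphicHamiltonianSystem (Ω : TwoForm m X) (H : X → ℂ) : Prop where
  symplectic : IsHolomorphicSymplectic Ω
  hamiltonian : ContMDiff 𝓘(ℂ, Cspace m) 𝓘(ℂ, ℂ) ω H

/-- The Hamiltonian vector field `X_F` of `F`, defined by `Ω(X_F, ·) = -dF`. -/
def hamVec (Ω : TwoForm m X) (F : X → ℂ) (x : X) : TangentSpace 𝓘(ℂ, Cspace m) x :=
  Classical.epsilon fun v => ∀ w : TangentSpace 𝓘(ℂ, Cspace m) x,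
    Ω x ![v, w] = -(differential F x w)

/-- The Poisson bracket `{F, G} = Ω(X_F, X_G)`. -/
def poisson (Ω : TwoForm m X) (F G : X → ℂ) (x : X) : ℂ :=
  Ω x ![hamVec Ω F x, hamVec Ω G x]

/-- Non-degeneracy makes the Hamiltonian vector field well defined: existence and uniqueness. -/
theorem hamVec_iff {Ω : TwoForm m X} (hΩ : IsHolomorphicSymplectic Ω) (F : X → ℂ) (x : X)
    (v : TangentSpace 𝓘(ℂ, Cspace m) x) :
    (∀ w : TangentSpace 𝓘(ℂ, Cspace m) x, Ω x ![v, w] = -(differential F x w)) ↔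
      v = hamVec Ω F x := by
  have e0 : ∀ a w b : TangentSpace 𝓘(ℂ, Cspace m) x, Function.update ![a, w] 0 b = ![b, w] := fun a w b => by
    ext i; fin_cases i <;> simp
  have e1 : ∀ a w b : TangentSpace 𝓘(ℂ, Cspace m) x, Function.update ![a, w] 1 b = ![a, b] := fun a w b => by
    ext i; fin_cases i <;> simp
  have hadd : ∀ a b w : TangentSpace 𝓘(ℂ, Cspace m) x,
      Ω x ![a + b, w] = Ω x ![a, w] + Ω x ![b, w] := fun a b w => by
    simpa only [e0] using (Ω x).map_update_add ![a, w] 0 a b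
  have hsmul : ∀ (c : ℂ) (a w : TangentSpace 𝓘(ℂ, Cspace m) x),
      Ω x ![c • a, w] = c * Ω x ![a, w] := fun c a w => by
    simpa only [e0, smul_eq_mul] using (Ω x).map_update_smul ![a, w] 0 c a
  have hadd' : ∀ w a b : TangentSpace 𝓘(ℂ, Cspace m) x,
      Ω x ![w, a + b] = Ω x ![w, a] + Ω x ![w, b] := fun w a b => by
    simpa only [e1] using (Ω x).map_update_add ![w, a] 1 a b
  have hsmul' : ∀ (c : ℂ) (w a : TangentSpace 𝓘(ℂ, Cspace m) x),
      Ω x ![w, c • a] = c * Ω x ![w, a] := fun c w a => by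
    simpa only [e1, smul_eq_mul] using (Ω x).map_update_smul ![w, a] 1 c a
  let L : TangentSpace 𝓘(ℂ, Cspace m) x →ₗ[ℂ] Module.Dual ℂ (TangentSpace 𝓘(ℂ, Cspace m) x) :=
    LinearMap.mk₂ ℂ (fun a w => Ω x ![a, w]) hadd hsmul hadd' hsmul'
  have : FiniteDimensional ℂ (TangentSpace 𝓘(ℂ, Cspace m) x) :=
    inferInstanceAs (FiniteDimensional ℂ (Cspace m))
  have hinj : Function.Injective L := by
    rw [injective_iff_map_eq_zero]
    intro a ha
    by_contra hne
    obtain ⟨w, hw⟩ := hΩ.nondegenerate x a hne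
    exact hw (LinearMap.congr_fun ha w)
  have hsurj : Function.Surjective L :=
    (LinearMap.injective_iff_surjective_of_finrank_eq_finrank
      (Subspace.dual_finrank_eq).symm).1 hinj
  obtain ⟨u, hu⟩ := hsurj (-(differential (m := m) F x).toLinearMap)
  have hex : ∃ u : TangentSpace 𝓘(ℂ, Cspace m) x, ∀ w : TangentSpace 𝓘(ℂ, Cspace m) x,
      Ω x ![u, w] = -(differential F x w) := ⟨u, fun w => LinearMap.congr_fun hu w⟩
  have hspec : ∀ w : TangentSpace 𝓘(ℂ, Cspace m) x,
      Ω x ![hamVec Ω F x, w] = -(differential F x w) := Classical.epsilon_spec hex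
  constructor
  · intro hv
    exact hinj (LinearMap.ext fun w => (hv w).trans (hspec w).symm)
  · rintro rfl
    exact hspec

/-- The function `F` is holomorphic on the set `U`. -/
def IsHolomorphicOn (F : X → ℂ) (U : Set X) : Prop :=
  ContMDiffOn 𝓘(ℂ, Cspace m) 𝓘(ℂ, ℂ) ω F U

/-- The Hamiltonian system `(X, Ω, H)`, `dim X = m`, is integrable near `x₀`: `m = 2n` is even
and on an open neighbourhood of `x₀` there are `n` Poisson-commuting holomorphic functions with
everywhere linearly independent differentials, the last one of which is `H`. -/
def IsIntegrableNear (Ω : TwoForm m X) (H : X → ℂ) (x₀ : X) : Prop :=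
  ∃ (n : ℕ) (hn : 0 < n) (_ : m = 2 * n) (U : Set X) (F : Fin n → X → ℂ),
    IsOpen U ∧ x₀ ∈ U ∧ (∀ i, IsHolomorphicOn (m := m) (F i) U) ∧
    Set.EqOn (F ⟨n - 1, by omega⟩) H U ∧
    (∀ x ∈ U, ∀ i j, poisson Ω (F i) (F j) x = 0) ∧
    (∀ x ∈ U, LinearIndependent ℂ fun i => differential (m := m) (F i) x)

/-- The Hamiltonian system `(X, Ω, H)` is regular: `dH` vanishes nowhere. -/
def IsRegular (H : X → ℂ) : Prop :=
  ∀ x : X, differential (m := m) H x ≠ 0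

/-- The Hamiltonian system `(X, Ω, H)` is locally integrable, i.e. integrable near every point. -/
def IsLocallyIntegrable (Ω : TwoForm m X) (H : X → ℂ) : Prop :=
  ∀ x₀ : X, IsIntegrableNear Ω H x₀

end Basic

end HolHam

end

/-! The heart is a holomorphic Darboux theorem in which one coordinate, `h = H`, is prescribed; the
Poisson relations are then read off from the normal form by linear algebra.

To split one conjugate pair off a closed nondegenerate form `B`, let `X` be the Hamiltonian field of
`h`. It does not vanish at the base point because `dh` does not. Straightening `X` gives a function
`g` with `dg(X) = 1`; let `Y` be the Hamiltonian field of `g`. Then `β = B - dh ∧ dg` is closed and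
annihilated by both `X` and `Y`. A closed form annihilated by a nonvanishing field is constant along
that field, so it descends to a space of one dimension less (`exists_reduction`). Two such
reductions carry `β` to a closed form two dimensions lower, still nondegenerate (`exists_split`).
Strong induction on the dimension finishes (`exists_darboux_of_fderiv_ne_zero`); evenness of the
dimension comes out of the same count.

The analytic input is the flow box theorem for a holomorphic field (`exists_flowBox`). Its flow,
with complex time, comes from the inverse function theorem: the integral equation, rescaled to the
real interval `[0, 1]`, is an analytic equation in the Banach space of continuous paths, because
composition with an analytic map is analytic there (`analyticAt_superpose`).

Nondegeneracy makes the functions found injective to first order, hence a chart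
(`exists_darbouxChart`). -/

noncomputable section

namespace HolHam

open Filter Topology Set

/-! ### Analyticity of composition with an analytic map, on spaces of continuous functions -/

section Superposition

variable {K : Type*} [TopologicalSpace K] [CompactSpace K]
  {E F : Type*} [NormedAddCommGroup E] [NormedSpace ℂ E] [NormedAddCommGroup F] [NormedSpace ℂ F]

/-- The superposition operator `u ↦ V ∘ u` on continuous maps, with value `0` where `V ∘ u` is not
continuous. -/
def superpose (K : Type*) [TopologicalSpace K] (V : E → F) (u : C(K, E)) : C(K, F) :=
  ContinuousMap.mkD (V ∘ u) 0

/-- A continuous multilinear map acts pointwise on continuous maps. -/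
def pointwiseMultilinear (K : Type*) [TopologicalSpace K] [CompactSpace K] {n : ℕ}
    (p : E [×n]→L[ℂ] F) : C(K, E) [×n]→L[ℂ] C(K, F) :=
  MultilinearMap.mkContinuous
    { toFun := fun u => ⟨fun s => p fun i => u i s, by fun_prop⟩
      map_update_add' := by
        intro _ u i a b
        ext s
        have h : ∀ c : C(K, E), (fun j => Function.update u i c j s)
            = Function.update (fun j => u j s) i (c s) := fun c => by
          ext j; by_cases hj : j = i
          · subst hj; simp
          · simp [hj]
        simp [h]
      map_update_smul' := by
        intro _ u i a b
        ext s
        have h : ∀ c : C(K, E), (fun j => Function.update u i c j s)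
            = Function.update (fun j => u j s) i (c s) := fun c => by
          ext j; by_cases hj : j = i
          · subst hj; simp
          · simp [hj]
        simp [h] } ‖p‖
    (fun u => (ContinuousMap.norm_le _ (by positivity)).2 fun s =>
      (p.le_opNorm _).trans (by
        gcongr with i
        exact (u i).norm_coe_le_norm s))

theorem norm_pointwiseMultilinear_le {n : ℕ} (p : E [×n]→L[ℂ] F) :
    ‖pointwiseMultilinear K p‖ ≤ ‖p‖ :=
  MultilinearMap.mkContinuous_norm_le _ (norm_nonneg _) _

theorem HasFPowerSeriesOnBall.continuous_comp {V : E → F} {p : FormalMultilinearSeries ℂ E F}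
    {x : E} {r : ENNReal} (hV : HasFPowerSeriesOnBall V p x r) {u : C(K, E)}
    (hu : u ∈ Metric.eball (0 : C(K, E)) r) : Continuous fun s => V (x + u s) := by
  refine continuous_iff_continuousAt.2 fun s => ?_
  have hmem : x + u s ∈ Metric.eball x r := by
    rw [Metric.mem_eball, edist_eq_enorm_sub, add_sub_cancel_left]
    rw [Metric.mem_eball, edist_zero_right] at hu
    exact lt_of_le_of_lt (enorm_le_iff_norm_le.2 (u.norm_coe_le_norm s)) hu
  have h1 : ContinuousAt V (x + u s) :=
    hV.continuousOn.continuousAt (Metric.isOpen_eball.mem_nhds hmem)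
  exact ContinuousAt.comp (f := fun s => x + u s) h1 (by fun_prop)

theorem eventually_forall_apply {E : Type*} [NormedAddCommGroup E] {P : E → Prop} {x : E} (hP : ∀ᶠ y in 𝓝 x, P y) :
    ∀ᶠ u : C(K, E) in 𝓝 (ContinuousMap.const K x), ∀ s, P (u s) := by
  obtain ⟨r, hr, h⟩ := Metric.eventually_nhds_iff.1 hP
  filter_upwards [Metric.ball_mem_nhds _ hr] with u hu s
  exact h (lt_of_le_of_lt (ContinuousMap.dist_apply_le_dist (f := u)
    (g := ContinuousMap.const K x) s) hu)

/-- Maps uniformly close to the constant `x` stay in a ball of convergence of `V`, so the composite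
is continuous and the default value `0` of `superpose` does not occur. -/
theorem eventually_superpose_apply {V : E → F} {x : E} (hV : AnalyticAt ℂ V x) :
    ∀ᶠ u : C(K, E) in 𝓝 (ContinuousMap.const K x), ∀ s, superpose K V u s = V (u s) := by
  obtain ⟨p, r, h⟩ := hV
  filter_upwards [Metric.eball_mem_nhds _ h.r_pos] with u hu s
  rw [superpose, ContinuousMap.mkD_apply_of_continuous]
  · rfl
  · have := HasFPowerSeriesOnBall.continuous_comp h (u := u - ContinuousMap.const K x) (by
      rw [Metric.mem_eball, edist_eq_enorm_sub] at hu
      rwa [Metric.mem_eball, edist_zero_right])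
    simpa [Function.comp_def] using this

variable [CompleteSpace F]

/-- Letting each Taylor coefficient act pointwise does not increase its norm, so the series
converges uniformly for `‖u‖ < r`; its values are identified by evaluating at each point. -/
theorem HasFPowerSeriesOnBall.superpose {V : E → F} {p : FormalMultilinearSeries ℂ E F}
    {x : E} {r : ENNReal} (hV : HasFPowerSeriesOnBall V p x r) :
    HasFPowerSeriesOnBall (superpose K V) (fun n => pointwiseMultilinear K (p n))
      (ContinuousMap.const K x) r where
  r_le := hV.r_le.trans
    (FormalMultilinearSeries.radius_le_of_le fun _ => norm_pointwiseMultilinear_le _)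
  r_pos := hV.r_pos
  hasSum := by
    intro u hu
    have hu' : ‖u‖ₑ < r := by rwa [Metric.mem_eball, edist_zero_right] at hu
    have hsum : Summable fun n : ℕ => pointwiseMultilinear K (p n) fun _ => u := by
      refine Summable.of_norm_bounded
        (p.summable_norm_mul_pow (r := ‖u‖₊) (lt_of_lt_of_le hu' hV.r_le)) fun n => ?_
      refine ((pointwiseMultilinear K (p n)).le_opNorm _).trans ?_
      simp only [Finset.prod_const, Finset.card_univ, Fintype.card_fin, coe_nnnorm]
      gcongr
      exact norm_pointwiseMultilinear_le _
    convert! hsum.hasSum using 1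
    ext s
    have h1 : HasSum (fun n : ℕ => p n fun _ => u s)
        ((∑' n : ℕ, pointwiseMultilinear K (p n) fun _ => u) s) :=
      hsum.hasSum.mapL (ContinuousMap.evalCLM ℂ s)
    have h2 := hV.hasSum (y := u s) (by
      rw [Metric.mem_eball, edist_zero_right]
      exact lt_of_le_of_lt (enorm_le_iff_norm_le.2 (u.norm_coe_le_norm s)) hu')
    rw [HolHam.superpose, ContinuousMap.mkD_apply_of_continuous]
    · exact h2.unique h1
    · exact HasFPowerSeriesOnBall.continuous_comp hV hu

theorem analyticAt_superpose {V : E → F} {x : E} (hV : AnalyticAt ℂ V x) :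
    AnalyticAt ℂ (superpose K V) (ContinuousMap.const K x) := by
  obtain ⟨p, r, h⟩ := hV
  exact ⟨_, r, HasFPowerSeriesOnBall.superpose h⟩

/-- Evaluation at `s` is continuous and linear, so both sides are derivatives of the single function
`u ↦ V (u s)`. -/
theorem eventually_fderiv_superpose_apply {V : E → F} {x : E} (hV : AnalyticAt ℂ V x) :
    ∀ᶠ u : C(K, E) in 𝓝 (ContinuousMap.const K x), ∀ (w : C(K, E)) (s : K),
      fderiv ℂ (superpose K V) u w s = fderiv ℂ V (u s) (w s) := by
  filter_upwards [(eventually_superpose_apply (K := K) hV).eventually_nhds,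
    (analyticAt_superpose (K := K) hV).eventually_analyticAt,
    eventually_forall_apply (K := K) hV.eventually_analyticAt] with u h1 h2 h3 w s
  have hA : HasFDerivAt (fun u => superpose K V u s)
      ((ContinuousMap.evalCLM ℂ s).comp (fderiv ℂ (superpose K V) u)) u :=
    HasFDerivAt.comp u (ContinuousMap.evalCLM (M := F) ℂ s).hasFDerivAt
      h2.differentiableAt.hasFDerivAt
  have hB : HasFDerivAt (fun u : C(K, E) => V (u s))
      ((fderiv ℂ V (u s)).comp (ContinuousMap.evalCLM ℂ s)) u :=
    HasFDerivAt.comp u (h3 s).differentiableAt.hasFDerivAt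
      (ContinuousMap.evalCLM (M := E) ℂ s).hasFDerivAt
  have hC := hA.congr_of_eventuallyEq (h1.mono fun y hy => (hy s).symm)
  exact DFunLike.congr_fun (hC.unique hB) w

end Superposition

/-! ### Integration as a bounded operator on paths -/

section Primitive

variable {E : Type*} [NormedAddCommGroup E] [NormedSpace ℂ E]

/-- The primitive vanishing at `0` of a continuous map on the unit interval. -/
def primitive : C(unitInterval, E) →L[ℂ] C(unitInterval, E) :=
  LinearMap.mkContinuous
    { toFun := fun u => ⟨fun s => ∫ t in (0 : ℝ)..s, ContinuousMap.IccExtendCM u t,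
        (intervalIntegral.continuous_primitive
          (fun a b => (ContinuousMap.IccExtendCM u).continuous.intervalIntegrable a b) 0).comp
          continuous_subtype_val⟩
      map_add' := fun u v => by
        ext s
        exact intervalIntegral.integral_add
          ((ContinuousMap.IccExtendCM u).continuous.intervalIntegrable _ _)
          ((ContinuousMap.IccExtendCM v).continuous.intervalIntegrable _ _)
      map_smul' := fun c u => by
        ext s
        exact intervalIntegral.integral_smul c _ } 1 (fun u => by
      rw [one_mul]
      refine (ContinuousMap.norm_le _ (norm_nonneg _)).2 fun s => ?_
      refine (intervalIntegral.norm_integral_le_of_norm_le_const (C := ‖u‖) fun t _ =>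
        u.norm_coe_le_norm _).trans ?_
      rw [sub_zero, abs_of_nonneg s.2.1]
      exact mul_le_of_le_one_right (norm_nonneg _) s.2.2)

theorem primitive_apply (u : C(unitInterval, E)) (s : unitInterval) :
    primitive u s = ∫ t in (0 : ℝ)..s, ContinuousMap.IccExtendCM u t := rfl

theorem primitive_const [CompleteSpace E] (e : E) (s : unitInterval) :
    primitive (ContinuousMap.const _ e) s = (s : ℂ) • e := by
  have : ∀ t : ℝ, ContinuousMap.IccExtendCM (ContinuousMap.const unitInterval e) t = e :=
    fun t => rfl
  simp [primitive_apply, this]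

end Primitive

/-! ### Holomorphic flows and the flow box theorem -/

section FlowBox

variable {E : Type*} [NormedAddCommGroup E] [NormedSpace ℂ E] [CompleteSpace E]

/-- A field along a path of the flow equation, multiplied by time, solves the inhomogeneous
linearised equation. -/
theorem primitive_time_smul {V : E → E} {u : C(unitInterval, E)} {a : E} {c : ℂ}
    (hV : ∀ s, AnalyticAt ℂ V (u s)) {f w g : C(unitInterval, E)} (hf : ∀ s, f s = V (u s))
    (hu : ∀ s, u s = a + c • primitive f s)
    (hw : ∀ s : unitInterval, w s = (s : ℂ) • V (u s))
    (hg : ∀ s, g s = fderiv ℂ V (u s) (w s)) :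
    w = primitive f + c • primitive g := by
  ext s
  set fe := ContinuousMap.IccExtendCM f
  set ge := ContinuousMap.IccExtendCM g
  have hfe : IntervalIntegrable fe MeasureTheory.volume 0 s :=
    fe.continuous.intervalIntegrable _ _
  have hge : IntervalIntegrable (fun t => c • ge t) MeasureTheory.volume 0 s :=
    (ge.continuous.const_smul c).intervalIntegrable _ _
  -- The path `u`, extended to all real times so that two-sided derivatives exist at the endpoints
  -- as well.
  let v : ℝ → E := fun t => a + c • ∫ r in (0 : ℝ)..t, fe r
  have hv : ∀ t, HasDerivAt v (c • fe t) t := fun t =>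
    ((fe.continuous.integral_hasStrictDerivAt 0 t).hasDerivAt.const_smul c).const_add a
  have hvu : ∀ t (ht : t ∈ Icc (0 : ℝ) 1), v t = u ⟨t, ht⟩ := fun t ht => (hu ⟨t, ht⟩).symm
  have hmem : ∀ t ∈ uIcc (0 : ℝ) s, t ∈ Icc (0 : ℝ) 1 := fun t ht => by
    rw [uIcc_of_le s.2.1] at ht
    exact ⟨ht.1, ht.2.trans s.2.2⟩
  have hd : ∀ t ∈ uIcc (0 : ℝ) s,
      HasDerivAt (fun t : ℝ => (t : ℂ) • V (v t)) (fe t + c • ge t) t := by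
    intro t ht
    have ht1 := hmem t ht
    have hVt := (hV ⟨t, ht1⟩).differentiableAt.hasFDerivAt
    rw [← hvu t ht1] at hVt
    have h1 := (hVt.restrictScalars ℝ).comp_hasDerivAt t (hv t)
    have h2 := (Complex.ofRealCLM.hasDerivAt (x := t)).smul h1
    refine h2.congr_deriv ?_
    have e1 : fe t = V (v t) := by
      rw [hvu t ht1, ← hf]; exact ContinuousMap.IccExtendCM_of_mem ht1
    have e2 : ge t = fderiv ℂ V (v t) ((t : ℂ) • V (v t)) := by
      rw [hvu t ht1]
      exact (ContinuousMap.IccExtendCM_of_mem ht1).trans ((hg _).trans (by rw [hw]))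
    rw [e2, e1]
    change (t : ℂ) • fderiv ℂ V (v t) (c • V (v t)) + ((1 : ℝ) : ℂ) • V (v t) = _
    rw [Complex.ofReal_one, one_smul, map_smul, map_smul, smul_comm, add_comm]
  have h := intervalIntegral.integral_eq_sub_of_hasDerivAt hd (hfe.add hge)
  rw [intervalIntegral.integral_add hfe hge, intervalIntegral.integral_smul] at h
  rw [hvu s s.2] at h
  simp only [Complex.ofReal_zero, zero_smul, sub_zero] at h
  rw [hw s, ← h]
  rfl

/-- The family of solutions of `u' = ℓ(x) V(u)`, `u(0) = x - ℓ(x) e`, in integrated form. -/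
theorem exists_analytic_solution {V : E → E} (hV : AnalyticAt ℂ V 0) (ℓ : E →L[ℂ] ℂ) :
    ∃ U : E → C(unitInterval, E), AnalyticAt ℂ U 0 ∧ U 0 = 0 ∧
      ∀ᶠ x in 𝓝 0, U x = ContinuousMap.const _ (x - ℓ x • V 0) +
        ℓ x • primitive (superpose unitInterval V (U x)) := by
  let C := C(unitInterval, E)
  let cst : E →L[ℂ] C := ContinuousLinearMap.const ℂ unitInterval
  let N : C → C := superpose unitInterval V
  have hN : AnalyticAt ℂ N 0 := analyticAt_superpose (K := unitInterval) hV
  let Pm : E →L[ℂ] E := ContinuousLinearMap.id ℂ E - ℓ.smulRight (V 0)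
  -- The second component vanishes exactly when `z.2` solves the integral equation with parameter
  -- `z.1`; solutions are obtained by inverting `f` at `(x, 0)`.
  let f : E × C → E × C := fun z => (z.1, z.2 - (cst (Pm z.1) + ℓ z.1 • primitive (N z.2)))
  have hf : AnalyticAt ℂ f 0 := by
    have h2 : AnalyticAt ℂ (fun z : E × C => N z.2) 0 :=
      AnalyticAt.fun_comp (f := fun z : E × C => z.2) hN analyticAt_snd
    have h3 : AnalyticAt ℂ (fun z : E × C => primitive (N z.2)) 0 :=
      (primitive.analyticAt _).fun_comp h2
    exact analyticAt_fst.prod (analyticAt_snd.sub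
      ((((cst.comp Pm).comp (ContinuousLinearMap.fst ℂ E C)).analyticAt 0).add
        (((ℓ.comp (ContinuousLinearMap.fst ℂ E C)).analyticAt 0).smul h3)))
  -- The nonlinear term carries the factor `ℓ z.1`, which vanishes at `0`, so it contributes nothing
  -- in the path direction. The derivative of `f` at `0` is therefore unipotent triangular, hence
  -- invertible.
  let S : E →L[ℂ] C := -(cst.comp Pm + ℓ.smulRight (primitive (N 0)))
  let e : (E × C) ≃L[ℂ] (E × C) :=
    ContinuousLinearEquiv.skewProd (.refl ℂ E) (.refl ℂ C) S
  have hf' : HasFDerivAt f (e : E × C →L[ℂ] E × C) 0 := by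
    have h2 : HasFDerivAt (fun z : E × C => N z.2)
        ((fderiv ℂ N 0).comp (ContinuousLinearMap.snd ℂ E C)) 0 :=
      HasFDerivAt.comp (0 : E × C) (g := N) (f := Prod.snd) hN.differentiableAt.hasFDerivAt
        hasFDerivAt_snd
    have h3 := HasFDerivAt.comp (0 : E × C) (primitive (E := E)).hasFDerivAt h2
    have h4 := (ℓ.comp (ContinuousLinearMap.fst ℂ E C)).hasFDerivAt (x := 0) |>.smul h3
    have h5 := ((cst.comp Pm).comp (ContinuousLinearMap.fst ℂ E C)).hasFDerivAt (x := 0)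
    have h6 := hasFDerivAt_fst (𝕜 := ℂ) (p := (0 : E × C)) |>.prodMk
      ((hasFDerivAt_snd (𝕜 := ℂ) (p := (0 : E × C))).sub (h5.add h4))
    refine h6.congr_fderiv ?_
    refine ContinuousLinearMap.ext fun z => Prod.ext rfl ?_
    simp [e, S, sub_eq_add_neg]
  have hs := (hf.contDiffAt (n := ω)).hasStrictFDerivAt' hf' (by simp)
  have hinv := (hf.contDiffAt (n := ω)).to_localInverse hf' (by simp)
  have hf0 : f 0 = 0 := by simp [f]
  have h00 := (hf.contDiffAt (n := ω)).localInverse_apply_image hf' (by simp)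
  have hr := hs.eventually_right_inverse
  rw [hf0] at hinv h00 hr
  set L := (hf.contDiffAt (n := ω)).localInverse hf' (by simp)
  refine ⟨fun x => (L (x, 0)).2, ?_, ?_, ?_⟩
  · have h1 : AnalyticAt ℂ (fun x : E => L (x, (0 : C))) 0 :=
      AnalyticAt.fun_comp (g := L) (f := fun x : E => (x, (0 : C))) hinv.analyticAt
        (analyticAt_id.prod analyticAt_const)
    exact (analyticAt_snd).fun_comp h1
  · exact congrArg Prod.snd h00
  · have ht : Tendsto (fun x : E => (x, (0 : C))) (𝓝 0) (𝓝 (0 : E × C)) :=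
      (Continuous.prodMk continuous_id continuous_const).tendsto' _ _ rfl
    filter_upwards [ht.eventually hr] with x hx
    have hx' : f (L (x, 0)) = (x, 0) := hx
    have e1 : (L (x, 0)).1 = x := congrArg Prod.fst hx'
    have e2 := congrArg Prod.snd hx'
    have e3 := sub_eq_zero.1 e2
    rw [e1] at e3
    exact e3

-- Since `ℓ x → 0` while `T ∘ A x` stays bounded, the operator has norm below `1` near `0`, and `0`
-- is its only fixed vector. This is the uniqueness needed for the linearised flow equation.
omit [CompleteSpace E] in
theorem eventually_eq_zero_of_smul_comp_eq {G : Type*} [NormedAddCommGroup G] [NormedSpace ℂ G]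
    (T : G →L[ℂ] G) (ℓ : E →L[ℂ] ℂ) {A : E → G →L[ℂ] G} (hA : AnalyticAt ℂ A 0) :
    ∀ᶠ x in 𝓝 0, ∀ d : G, ℓ x • T (A x d) = d → d = 0 := by
  have hA' : ContinuousAt (fun x => T.comp (A x)) 0 :=
    ((ContinuousLinearMap.compL ℂ G G G T).continuous.continuousAt).comp hA.continuousAt
  have h := (ℓ.continuous.continuousAt.smul hA').norm
  have h' : Tendsto (fun x => ‖ℓ x • T.comp (A x)‖) (𝓝 0) (𝓝 0) := by
    simpa [ContinuousAt] using h
  filter_upwards [h'.eventually (gt_mem_nhds one_pos)] with x hx d hd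
  by_contra hne
  have hpos : 0 < ‖d‖ := norm_pos_iff.2 hne
  have h1 := (ℓ x • T.comp (A x)).le_opNorm d
  have h2 : (ℓ x • T.comp (A x)) d = d := hd
  rw [h2] at h1
  nlinarith

/-- The flow of `V` from the kernel of `ℓ`, with flow time `ℓ`. -/
theorem exists_flow {V : E → E} (hV : AnalyticAt ℂ V 0) (ℓ : E →L[ℂ] ℂ) (hℓ : ℓ (V 0) = 1) :
    ∃ Φ : E → E, AnalyticAt ℂ Φ 0 ∧ Φ 0 = 0 ∧ HasFDerivAt Φ (ContinuousLinearMap.id ℂ E) 0 ∧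
      ∀ᶠ x in 𝓝 0, fderiv ℂ Φ x (V 0) = V (Φ x) := by
  obtain ⟨U, hU, hU0, hUeq⟩ := exists_analytic_solution hV ℓ
  let cst : E →L[ℂ] C(unitInterval, E) := ContinuousLinearMap.const ℂ unitInterval
  let N : C(unitInterval, E) → C(unitInterval, E) := superpose unitInterval V
  have hN : AnalyticAt ℂ N 0 := analyticAt_superpose (K := unitInterval) hV
  let Pm : E →L[ℂ] E := ContinuousLinearMap.id ℂ E - ℓ.smulRight (V 0)
  have hUc : Tendsto U (𝓝 0) (𝓝 (0 : C(unitInterval, E))) := by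
    have := hU.continuousAt
    rwa [ContinuousAt, hU0] at this
  have hderiv : ∀ᶠ x in 𝓝 0, ∀ v, fderiv ℂ U x v = cst (Pm v) +
      (ℓ v • primitive (N (U x)) +
        ℓ x • primitive (fderiv ℂ N (U x) (fderiv ℂ U x v))) := by
    filter_upwards [hUeq.eventually_nhds, hUc.eventually hN.eventually_analyticAt,
      hU.eventually_analyticAt] with x h1 h2 h3 v
    have h4 := HasFDerivAt.comp x h2.differentiableAt.hasFDerivAt h3.differentiableAt.hasFDerivAt
    have h5 := HasFDerivAt.comp x (primitive (E := E)).hasFDerivAt h4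
    have h6 := ((cst.comp Pm).hasFDerivAt (x := x)).add ((ℓ.hasFDerivAt (x := x)).smul h5)
    have h7 := h6.congr_of_eventuallyEq h1
    rw [add_comm (ℓ v • _)]
    exact DFunLike.congr_fun h7.fderiv v
  let ev : C(unitInterval, E) →L[ℂ] E := ContinuousMap.evalCLM ℂ (1 : unitInterval)
  have hΦ : ∀ᶠ x in 𝓝 0, HasFDerivAt (fun x => ev (U x)) (ev.comp (fderiv ℂ U x)) x := by
    filter_upwards [hU.eventually_analyticAt] with x h
    exact HasFDerivAt.comp x ev.hasFDerivAt h.differentiableAt.hasFDerivAt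
  refine ⟨fun x => ev (U x), (ev.analyticAt _).fun_comp hU, by simp [hU0], ?_, ?_⟩
  · refine hΦ.self_of_nhds.congr_fderiv (ContinuousLinearMap.ext fun v => ?_)
    have hN0 : N (U 0) = ContinuousMap.const _ (V 0) := by
      ext s
      rw [hU0]
      exact (eventually_superpose_apply (K := unitInterval) hV).self_of_nhds s
    have h := hderiv.self_of_nhds v
    rw [hN0] at h
    have h1 : ev (primitive (ContinuousMap.const _ (V 0))) = V 0 := by
      change primitive (ContinuousMap.const _ (V 0)) 1 = V 0
      simp [primitive_const]
    rw [ContinuousLinearMap.comp_apply, h]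
    simp only [map_add, map_smul, map_zero, zero_smul, add_zero, h1]
    change Pm v + _ = v
    simp [Pm]
  · have hNU' : AnalyticAt ℂ (fun x => fderiv ℂ N (U x)) 0 := by
      refine AnalyticAt.fun_comp ?_ hU
      rw [hU0]; exact hN.fderiv
    have hM := eventually_eq_zero_of_smul_comp_eq primitive ℓ hNU'
    filter_upwards [hΦ, hderiv, hM, hUeq,
      hUc.eventually (eventually_superpose_apply (K := unitInterval) hV),
      hUc.eventually (eventually_fderiv_superpose_apply (K := unitInterval) hV),
      hUc.eventually (eventually_forall_apply (K := unitInterval) hV.eventually_analyticAt)]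
      with x h1 h2 h3 h4 h5 h6 h7
    -- The expected variation of the path when only the flow time changes: `s` times the velocity
    -- `V`. It and the derivative of `U` along `V 0` solve the same linear equation.
    let w : C(unitInterval, E) := ⟨fun s => (s : ℂ) • N (U x) s, by fun_prop⟩
    have hw : w = primitive (N (U x)) + ℓ x • primitive (fderiv ℂ N (U x) w) :=
      primitive_time_smul (V := V) (u := U x) (a := x - ℓ x • V 0) (c := ℓ x) h7 h5
        (fun s => DFunLike.congr_fun h4 s)
        (fun s => congrArg ((s : ℂ) • ·) (h5 s)) (fun s => h6 w s)
    have h2' := h2 (V 0)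
    -- Moving `x` along `V 0` fixes the starting point `x - ℓ x • V 0` and increases the flow time
    -- at unit rate.
    have hP : Pm (V 0) = 0 := by simp [Pm, hℓ]
    rw [hP, hℓ, map_zero, zero_add, one_smul] at h2'
    set w' := fderiv ℂ U x (V 0)
    have hzero : w' = w := by
      refine sub_eq_zero.1 (h3 (w' - w) ?_)
      rw [map_sub, map_sub, smul_sub]
      conv_rhs => rw [h2', hw]
      abel
    rw [h1.fderiv]
    change ev w' = _
    rw [hzero]
    change ((1 : unitInterval) : ℂ) • N (U x) 1 = V (U x 1)
    rw [← h5 1]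
    simp [N]

/-- Flow box theorem: local holomorphic coordinates in which `V` is constant. -/
theorem exists_flowBox {V : E → E} (hV : AnalyticAt ℂ V 0) (ℓ : E →L[ℂ] ℂ)
    (hℓ : ℓ (V 0) = 1) :
    ∃ Φ Ψ : E → E, AnalyticAt ℂ Φ 0 ∧ AnalyticAt ℂ Ψ 0 ∧ Φ 0 = 0 ∧ Ψ 0 = 0 ∧
      (∀ᶠ x in 𝓝 0, Ψ (Φ x) = x) ∧ (∀ᶠ x in 𝓝 0, Φ (Ψ x) = x) ∧
      (∀ᶠ x in 𝓝 0, fderiv ℂ Φ x (V 0) = V (Φ x)) ∧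
      ∀ᶠ x in 𝓝 0, fderiv ℂ Ψ x (V x) = V 0 := by
  obtain ⟨Φ, hΦ, hΦ0, hΦ', hΦV⟩ := exists_flow hV ℓ hℓ
  have hd : HasFDerivAt Φ ((ContinuousLinearEquiv.refl ℂ E : E ≃L[ℂ] E) : E →L[ℂ] E) 0 := hΦ'
  have hs := (hΦ.contDiffAt (n := ω)).hasStrictFDerivAt' hd (by simp)
  have hinv := (hΦ.contDiffAt (n := ω)).to_localInverse hd (by simp)
  have h0 := (hΦ.contDiffAt (n := ω)).localInverse_apply_image hd (by simp)
  have hr := hs.eventually_right_inverse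
  have hl := hs.eventually_left_inverse
  rw [hΦ0] at hinv h0 hr
  set Ψ := (hΦ.contDiffAt (n := ω)).localInverse hd (by simp)
  refine ⟨Φ, Ψ, hΦ, hinv.analyticAt, hΦ0, h0, hl, hr, hΦV, ?_⟩
  have hΨc : Tendsto Ψ (𝓝 0) (𝓝 0) := by
    have := hinv.continuousAt
    rwa [ContinuousAt, h0] at this
  filter_upwards [hr, hinv.analyticAt.eventually_analyticAt, hΨc.eventually hΦV,
    hΨc.eventually hΦ.eventually_analyticAt, hΨc.eventually hl.eventually_nhds]
    with x h1 h2 h3 h4 h5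
  change Φ (Ψ x) = x at h1
  rw [← h1] at h2
  have h6 := HasFDerivAt.comp (Ψ x) h2.differentiableAt.hasFDerivAt
    h4.differentiableAt.hasFDerivAt
  have h7 := (hasFDerivAt_id (𝕜 := ℂ) (Ψ x)).congr_of_eventuallyEq h5
  have h8 := DFunLike.congr_fun (h6.unique h7) (V 0)
  rw [ContinuousLinearMap.comp_apply, h3, h1] at h8
  exact h8

end FlowBox

/-! ### Closed two-forms: pullbacks, differences, wedge products -/

section Forms

variable {E F G : Type*} [NormedAddCommGroup E] [NormedSpace ℂ E]
  [NormedAddCommGroup F] [NormedSpace ℂ F] [NormedAddCommGroup G] [NormedSpace ℂ G]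

/-- The pullback of a field of bilinear forms. -/
def pullback (B : F → F →L[ℂ] F →L[ℂ] ℂ) (f : E → F) (x : E) : E →L[ℂ] E →L[ℂ] ℂ :=
  (B (f x)).bilinearComp (fderiv ℂ f x) (fderiv ℂ f x)

@[simp]
theorem pullback_apply (B : F → F →L[ℂ] F →L[ℂ] ℂ) (f : E → F) (x a b : E) :
    pullback B f x a b = B (f x) (fderiv ℂ f x a) (fderiv ℂ f x b) := rfl

theorem analyticAt_pullback [CompleteSpace F] {B : F → F →L[ℂ] F →L[ℂ] ℂ} {f : E → F} {x : E}
    (hB : AnalyticAt ℂ B (f x)) (hf : AnalyticAt ℂ f x) : AnalyticAt ℂ (pullback B f) x := by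
  have h1 : ContDiffAt ℂ ω (fun x => B (f x)) x := (hB.fun_comp hf).contDiffAt
  have h2 : ContDiffAt ℂ ω (fderiv ℂ f) x := hf.fderiv.contDiffAt
  let T : (E →L[ℂ] F) →L[ℂ] (F →L[ℂ] ℂ) →L[ℂ] E →L[ℂ] ℂ :=
    (ContinuousLinearMap.compL ℂ E F ℂ).flip
  have hT : ContDiff ℂ ω T := by fun_prop
  have h3 : ContDiffAt ℂ ω (fun x => T (fderiv ℂ f x)) x :=
    hT.contDiffAt.comp x h2
  exact (h3.clm_comp (h1.clm_comp h2)).analyticAt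

theorem fderiv_apply_apply {B : E → F →L[ℂ] G →L[ℂ] ℂ} {x : E} (hB : DifferentiableAt ℂ B x)
    (a : F) (b : G) (c : E) : fderiv ℂ (fun y => B y a b) x c = fderiv ℂ B x c a b := by
  have h := (hB.hasFDerivAt.clm_apply (hasFDerivAt_const a x)).clm_apply (hasFDerivAt_const b x)
  rw [h.fderiv]
  simp

theorem fderiv_pullback_apply [CompleteSpace F] {B : F → F →L[ℂ] F →L[ℂ] ℂ} {f : E → F} {x : E}
    (hB : AnalyticAt ℂ B (f x)) (hf : AnalyticAt ℂ f x) (a b c : E) :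
    fderiv ℂ (pullback B f) x c a b =
      fderiv ℂ B (f x) (fderiv ℂ f x c) (fderiv ℂ f x a) (fderiv ℂ f x b)
      + B (f x) (fderiv ℂ (fderiv ℂ f) x c a) (fderiv ℂ f x b)
      + B (f x) (fderiv ℂ f x a) (fderiv ℂ (fderiv ℂ f) x c b) := by
  rw [← fderiv_apply_apply (analyticAt_pullback hB hf).differentiableAt]
  have h1 := HasFDerivAt.comp x hB.differentiableAt.hasFDerivAt hf.differentiableAt.hasFDerivAt
  have h2 := hf.fderiv.differentiableAt.hasFDerivAt
  have h3 := (h1.clm_apply (h2.clm_apply (hasFDerivAt_const a x))).clm_apply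
    (h2.clm_apply (hasFDerivAt_const b x))
  refine (DFunLike.congr_fun (HasFDerivAt.fderiv h3) c).trans ?_
  simp
  ring

/-- The cyclic sum of the derivative of a field of alternating forms, i.e. its exterior
derivative, vanishes at `x`. -/
def IsClosedAt (B : E → E →L[ℂ] E →L[ℂ] ℂ) (x : E) : Prop :=
  ∀ a b c, fderiv ℂ B x a b c + fderiv ℂ B x b c a + fderiv ℂ B x c a b = 0

/-- In the cyclic sum the terms with second derivatives of `f` cancel in pairs, by symmetry of `D²f`
and skewness of `B`. -/
theorem isClosedAt_pullback [CompleteSpace F] {B : F → F →L[ℂ] F →L[ℂ] ℂ} {f : E → F} {x : E}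
    (hB : AnalyticAt ℂ B (f x)) (hf : AnalyticAt ℂ f x) (halt : ∀ a b, B (f x) a b = -B (f x) b a)
    (hc : IsClosedAt B (f x)) : IsClosedAt (pullback B f) x := by
  intro a b c
  have hs : IsSymmSndFDerivAt ℂ f x :=
    (hf.contDiffAt (n := ω)).isSymmSndFDerivAt (by simp)
  simp only [fderiv_pullback_apply hB hf]
  have h := hc (fderiv ℂ f x a) (fderiv ℂ f x b) (fderiv ℂ f x c)
  rw [hs c a, hs c b, hs b a, halt (fderiv ℂ f x b) (fderiv ℂ (fderiv ℂ f) x a c),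
    halt (fderiv ℂ f x c) (fderiv ℂ (fderiv ℂ f) x a b),
    halt (fderiv ℂ f x a) (fderiv ℂ (fderiv ℂ f) x b c)]
  linear_combination h

/-- The germ at `0` of a closed holomorphic `2`-form. -/
structure IsClosedTwoForm (B : E → E →L[ℂ] E →L[ℂ] ℂ) : Prop where
  analyticAt : AnalyticAt ℂ B 0
  alt : ∀ x a b, B x a b = -B x b a
  closed : ∀ᶠ x in 𝓝 0, IsClosedAt B x

theorem IsClosedTwoForm.pullback [CompleteSpace F] {B : F → F →L[ℂ] F →L[ℂ] ℂ}
    (hB : IsClosedTwoForm B) {f : E → F} (hf : AnalyticAt ℂ f 0) (hf0 : f 0 = 0) :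
    IsClosedTwoForm (pullback B f) where
  analyticAt := analyticAt_pullback (by rw [hf0]; exact hB.analyticAt) hf
  alt x a b := hB.alt _ _ _
  closed := by
    have hc : Tendsto f (𝓝 0) (𝓝 0) := by
      have := hf.continuousAt
      rwa [ContinuousAt, hf0] at this
    filter_upwards [hc.eventually hB.closed, hc.eventually hB.analyticAt.eventually_analyticAt,
      hf.eventually_analyticAt] with x h1 h2 h3
    exact isClosedAt_pullback h2 h3 (hB.alt _) h1

theorem IsClosedTwoForm.sub {B C : E → E →L[ℂ] E →L[ℂ] ℂ} (hB : IsClosedTwoForm B)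
    (hC : IsClosedTwoForm C) : IsClosedTwoForm (fun x => B x - C x) where
  analyticAt := hB.analyticAt.sub hC.analyticAt
  alt x a b := by
    change B x a b - C x a b = -(B x b a - C x b a)
    rw [hB.alt, hC.alt]; ring
  closed := by
    filter_upwards [hB.closed, hC.closed, hB.analyticAt.eventually_analyticAt,
      hC.analyticAt.eventually_analyticAt] with x h1 h2 h3 h4 a b c
    rw [fderiv_fun_sub h3.differentiableAt h4.differentiableAt]
    change (fderiv ℂ B x a b c - fderiv ℂ C x a b c) + (fderiv ℂ B x b c a - fderiv ℂ C x b c a)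
      + (fderiv ℂ B x c a b - fderiv ℂ C x c a b) = 0
    linear_combination h1 a b c - h2 a b c

/-- The form `dh ∧ dg`. -/
def wedgeForm (h g : E → ℂ) (x : E) : E →L[ℂ] E →L[ℂ] ℂ :=
  (fderiv ℂ h x).smulRight (fderiv ℂ g x) - (fderiv ℂ g x).smulRight (fderiv ℂ h x)

@[simp]
theorem wedgeForm_apply (h g : E → ℂ) (x a b : E) :
    wedgeForm h g x a b =
      fderiv ℂ h x a * fderiv ℂ g x b - fderiv ℂ g x a * fderiv ℂ h x b := by
  simp [wedgeForm]

theorem isClosedTwoForm_wedgeForm {h g : E → ℂ} (hh : AnalyticAt ℂ h 0) (hg : AnalyticAt ℂ g 0) :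
    IsClosedTwoForm (wedgeForm h g) := by
  have hana : AnalyticAt ℂ (wedgeForm h g) 0 := by
    have h1 : ContDiffAt ℂ ω (fderiv ℂ h) 0 := hh.fderiv.contDiffAt
    have h2 : ContDiffAt ℂ ω (fderiv ℂ g) 0 := hg.fderiv.contDiffAt
    exact ((h1.smulRight h2).sub (h2.smulRight h1)).analyticAt
  refine ⟨hana, fun x a b => by simp; ring, ?_⟩
  filter_upwards [hana.eventually_analyticAt, hh.eventually_analyticAt,
    hg.eventually_analyticAt] with x h1 h2 h3
  have hd : ∀ a b c, fderiv ℂ (wedgeForm h g) x c a b =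
      fderiv ℂ (fderiv ℂ h) x c a * fderiv ℂ g x b + fderiv ℂ h x a * fderiv ℂ (fderiv ℂ g) x c b
      - (fderiv ℂ (fderiv ℂ g) x c a * fderiv ℂ h x b
        + fderiv ℂ g x a * fderiv ℂ (fderiv ℂ h) x c b) := by
    intro a b c
    rw [← fderiv_apply_apply h1.differentiableAt]
    simp only [wedgeForm_apply]
    have k1 := h2.fderiv.differentiableAt.hasFDerivAt
    have k2 := h3.fderiv.differentiableAt.hasFDerivAt
    have k3 := ((k1.clm_apply (hasFDerivAt_const a x)).mul
      (k2.clm_apply (hasFDerivAt_const b x))).sub ((k2.clm_apply (hasFDerivAt_const a x)).mul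
      (k1.clm_apply (hasFDerivAt_const b x)))
    refine (DFunLike.congr_fun (HasFDerivAt.fderiv k3) c).trans ?_
    simp
    ring
  have s1 : IsSymmSndFDerivAt ℂ h x := (h2.contDiffAt (n := ω)).isSymmSndFDerivAt (by simp)
  have s2 : IsSymmSndFDerivAt ℂ g x := (h3.contDiffAt (n := ω)).isSymmSndFDerivAt (by simp)
  intro a b c
  simp only [hd]
  rw [s1 b a, s1 c a, s1 c b, s2 b a, s2 c a, s2 c b]
  ring

end Forms

/-! ### Descending a closed form along a field that annihilates it -/

section Reduction

variable {E : Type*} [NormedAddCommGroup E] [NormedSpace ℂ E]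

theorem tendsto_zero_of_analyticAt {F : Type*} [NormedAddCommGroup F] [NormedSpace ℂ F]
    {f : E → F} (hf : AnalyticAt ℂ f 0) (hf0 : f 0 = 0) : Tendsto f (𝓝 0) (𝓝 0) := by
  have := hf.continuousAt
  rwa [ContinuousAt, hf0] at this

theorem fderiv_comp_eq_id {F : Type*} [NormedAddCommGroup F] [NormedSpace ℂ F]
    {f : E → F} {g : F → E} {x : E} (hf : AnalyticAt ℂ f x) (hg : AnalyticAt ℂ g (f x))
    (hgf : ∀ᶠ y in 𝓝 x, g (f y) = y) (v : E) : fderiv ℂ g (f x) (fderiv ℂ f x v) = v := by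
  have h1 := HasFDerivAt.comp x hg.differentiableAt.hasFDerivAt hf.differentiableAt.hasFDerivAt
  have h2 := (hasFDerivAt_id (𝕜 := ℂ) x).congr_of_eventuallyEq hgf
  exact DFunLike.congr_fun (h1.unique h2) v

/-- A function with vanishing derivative in the direction `e` is constant along that direction. -/
theorem eventually_eq_of_fderiv_apply_eq_zero {F : Type*} [NormedAddCommGroup F]
    [NormedSpace ℂ F] [CompleteSpace F] {f : E → F} {e : E} (hf : AnalyticAt ℂ f 0)
    (h : ∀ᶠ x in 𝓝 0, fderiv ℂ f x e = 0) (ℓ : E →L[ℂ] ℂ) :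
    ∀ᶠ x in 𝓝 0, f x = f (x - ℓ x • e) := by
  obtain ⟨r, hr, hball⟩ := Metric.eventually_nhds_iff_ball.1 (h.and hf.eventually_analyticAt)
  have ht : Tendsto (fun x : E => x - ℓ x • e) (𝓝 0) (𝓝 0) :=
    Continuous.tendsto' (by fun_prop) _ _ (by simp)
  filter_upwards [Metric.ball_mem_nhds (0 : E) hr, ht.eventually (Metric.ball_mem_nhds (0 : E) hr)]
    with x hx hy
  -- The segment from `x` to `y` stays in the ball and has direction a multiple of `e`, so `f` has
  -- zero derivative along it.
  set y := x - ℓ x • e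
  have hmem : ∀ t ∈ Icc (0 : ℝ) 1, x + t • (y - x) ∈ Metric.ball (0 : E) r := fun t ht =>
    (convex_ball (0 : E) r).add_smul_sub_mem hx hy ht
  have hd : ∀ t ∈ Icc (0 : ℝ) 1, HasDerivAt (fun t : ℝ => f (x + t • (y - x))) 0 t := by
    intro t ht
    obtain ⟨h1, h2⟩ := hball _ (hmem t ht)
    have h3 := (h2.differentiableAt.hasFDerivAt.restrictScalars ℝ).comp_hasDerivAt t
      (((hasDerivAt_id t).smul_const (y - x)).const_add x)
    refine h3.congr_deriv ?_
    have : y - x = (-ℓ x) • e := by simp [y]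
    rw [one_smul]
    calc fderiv ℂ f (x + t • (y - x)) (y - x)
        = fderiv ℂ f (x + t • (y - x)) ((-ℓ x) • e) := congrArg _ this
      _ = 0 := by rw [map_smul, h1, smul_zero]
  have := constant_of_has_deriv_right_zero
    (fun t ht => (hd t ht).continuousAt.continuousWithinAt)
    (fun t ht => (hd t (Ico_subset_Icc_self ht)).hasDerivWithinAt) 1 (by simp)
  simpa using this.symm

/-- A closed form annihilated by a field `V` is locally the pullback of a closed form on a space
of one dimension less. -/
theorem exists_reduction [FiniteDimensional ℂ E] {B : E → E →L[ℂ] E →L[ℂ] ℂ}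
    (hB : IsClosedTwoForm B) {V : E → E} (hV : AnalyticAt ℂ V 0) (hV0 : V 0 ≠ 0)
    (hBV : ∀ᶠ x in 𝓝 0, ∀ b, B x (V x) b = 0) :
    ∃ (E' : Submodule ℂ E) (σ : E' → E) (π : E → E'),
      Module.finrank ℂ E' + 1 = Module.finrank ℂ E ∧
      AnalyticAt ℂ σ 0 ∧ AnalyticAt ℂ π 0 ∧ σ 0 = 0 ∧ π 0 = 0 ∧
      (∀ᶠ y in 𝓝 0, π (σ y) = y) ∧
      (∀ᶠ x in 𝓝 0, ∀ a b, B x a b =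
        pullback B σ (π x) (fderiv ℂ π x a) (fderiv ℂ π x b)) ∧
      (∀ᶠ x in 𝓝 0, fderiv ℂ π x (V x) = 0) ∧
      ∀ v, fderiv ℂ π 0 v = 0 → ∃ c : ℂ, v = c • V 0 := by
  have := FiniteDimensional.complete ℂ E
  obtain ⟨ℓ, hℓ⟩ := SeparatingDual.exists_eq_one (R := ℂ) hV0
  obtain ⟨Φ, Ψ, hΦ, hΨ, hΦ0, hΨ0, hΨΦ, hΦΨ, hΦV, hΨV⟩ := exists_flowBox hV ℓ hℓ
  set e := V 0
  have hΦc := tendsto_zero_of_analyticAt hΦ hΦ0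
  have hΨc := tendsto_zero_of_analyticAt hΨ hΨ0
  -- The hyperplane `ker ℓ` is a slice transverse to `e` in flow box coordinates, and `P` projects
  -- onto it along `e`.
  let E' : Submodule ℂ E := LinearMap.ker (ℓ : E →ₗ[ℂ] ℂ)
  let P : E →L[ℂ] E' := (ContinuousLinearMap.id ℂ E - ℓ.smulRight e).codRestrict E' fun x => by
    simp [E', hℓ]
  have hP : ∀ x, (P x : E) = x - ℓ x • e := fun x => by simp [P]
  have hPE : ∀ y : E', P (y : E) = y := fun y => Subtype.ext <| by
    have : ℓ (y : E) = 0 := y.2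
    simp [hP, this]
  have hPe : P e = 0 := Subtype.ext <| by simp [hP, hℓ]
  let ι : E' →L[ℂ] E := E'.subtypeL
  have hιc : Tendsto ι (𝓝 0) (𝓝 0) := ι.continuous.tendsto' _ _ (map_zero ι)
  have hσ : AnalyticAt ℂ (fun y => Φ (ι y)) 0 :=
    AnalyticAt.fun_comp (by rw [map_zero]; exact hΦ) (ι.analyticAt 0)
  have hπ : AnalyticAt ℂ (fun x => P (Ψ x)) 0 := (P.analyticAt _).fun_comp hΨ
  have hπc : Tendsto (fun x => P (Ψ x)) (𝓝 0) (𝓝 0) :=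
    tendsto_zero_of_analyticAt hπ (by simp [hΨ0])
  have hDσ : ∀ᶠ y in 𝓝 0, ∀ a, fderiv ℂ (fun y => Φ (ι y)) y a = fderiv ℂ Φ (ι y) a := by
    filter_upwards [hιc.eventually hΦ.eventually_analyticAt] with y hy a
    have := HasFDerivAt.comp y hy.differentiableAt.hasFDerivAt (ι.hasFDerivAt (x := y))
    exact DFunLike.congr_fun (HasFDerivAt.fderiv this) a
  have hDπ : ∀ᶠ x in 𝓝 0, ∀ a, fderiv ℂ (fun x => P (Ψ x)) x a = P (fderiv ℂ Ψ x a) := by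
    filter_upwards [hΨ.eventually_analyticAt] with x hx a
    have := HasFDerivAt.comp x (P.hasFDerivAt (x := Ψ x)) hx.differentiableAt.hasFDerivAt
    exact DFunLike.congr_fun (HasFDerivAt.fderiv this) a
  have hDΦΨ : ∀ᶠ x in 𝓝 0, ∀ a, fderiv ℂ Φ (Ψ x) (fderiv ℂ Ψ x a) = a := by
    filter_upwards [hΨ.eventually_analyticAt, hΨc.eventually hΦ.eventually_analyticAt,
      hΦΨ.eventually_nhds] with x h1 h2 h3 a
    exact fderiv_comp_eq_id h1 h2 h3 a
  -- the form in the coordinates of the flow box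
  set Bf := pullback B Φ with hBf
  have hBfc : IsClosedTwoForm Bf := hB.pullback hΦ hΦ0
  have hBfe : ∀ᶠ x in 𝓝 0, ∀ b, Bf x e b = 0 := by
    filter_upwards [hΦV, hΦc.eventually hBV] with x h1 h2 b
    rw [hBf, pullback_apply, h1, h2]
  -- Cartan's formula for the constant field `e`: in the closedness identity for `e, a, b`, the two
  -- terms in which `e` is inserted into the form vanish, leaving the derivative along `e`.
  have hBfd : ∀ᶠ x in 𝓝 0, fderiv ℂ Bf x e = 0 := by
    filter_upwards [hBfe.eventually_nhds, hBfc.closed, hBfc.analyticAt.eventually_analyticAt]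
      with x h1 h2 h3
    have k1 : ∀ b c, fderiv ℂ Bf x c e b = 0 := fun b c => by
      rw [← fderiv_apply_apply h3.differentiableAt]
      have : (fun y => Bf y e b) =ᶠ[𝓝 x] fun _ => 0 := h1.mono fun y hy => hy b
      rw [this.fderiv_eq]; simp
    have k2 : ∀ b c, fderiv ℂ Bf x c b e = 0 := fun b c => by
      rw [← fderiv_apply_apply h3.differentiableAt]
      have : (fun y => Bf y b e) =ᶠ[𝓝 x] fun _ => 0 := h1.mono fun y hy => by
        change Bf y b e = 0
        rw [hBfc.alt, hy b, neg_zero]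
      rw [this.fderiv_eq]; simp
    ext a b
    have := h2 e a b
    rw [k2, k1, add_zero, add_zero] at this
    exact this
  have hinv := eventually_eq_of_fderiv_apply_eq_zero hBfc.analyticAt hBfd ℓ
  refine ⟨E', fun y => Φ (ι y), fun x => P (Ψ x), ?_, hσ, hπ, by simp [hΦ0], by simp [hΨ0],
    ?_, ?_, ?_, ?_⟩
  · have h := LinearMap.finrank_range_add_finrank_ker (ℓ : E →ₗ[ℂ] ℂ)
    have hr : LinearMap.range (ℓ : E →ₗ[ℂ] ℂ) = ⊤ :=
      LinearMap.range_eq_top.2 fun c => ⟨c • e, by simp [hℓ]⟩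
    rw [hr, finrank_top, Module.finrank_self, add_comm] at h
    exact h
  · filter_upwards [hιc.eventually hΨΦ] with y hy
    rw [hy]
    exact hPE y
  · filter_upwards [hDΦΨ, hDπ, hΦΨ, hπc.eventually hDσ, hΨc.eventually hinv, hΨc.eventually hBfe]
      with x h1 h2 h3 h4 h5 h6 a b
    have k : ∀ a b, Bf (Ψ x) a b = Bf (Ψ x) (P a) (P b) := fun a b => by
      have k1 : Bf (Ψ x) e = 0 := ContinuousLinearMap.ext h6
      have k2 : Bf (Ψ x) a e = 0 := by rw [hBfc.alt, h6, neg_zero]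
      simp [hP, k1, k2]
    calc B x a b = Bf (Ψ x) (fderiv ℂ Ψ x a) (fderiv ℂ Ψ x b) := by
          rw [hBf, pullback_apply, h1, h1, h3]
      _ = _ := by
          change _ = B _ (fderiv ℂ (fun y => Φ (ι y)) (P (Ψ x)) (fderiv ℂ (fun x => P (Ψ x)) x a))
            (fderiv ℂ (fun y => Φ (ι y)) (P (Ψ x)) (fderiv ℂ (fun x => P (Ψ x)) x b))
          rw [h4, h4, h2, h2, k, h5, ← hP]
          rfl
  · filter_upwards [hDπ, hΨV] with x h1 h2
    rw [h1, h2, hPe]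
  · intro v hv
    rw [hDπ.self_of_nhds] at hv
    have h1 := congrArg (Subtype.val) hv
    rw [hP] at h1
    have h2 := sub_eq_zero.1 h1
    have h3 := hDΦΨ.self_of_nhds v
    rw [h2, map_smul, hΨ0, hΦV.self_of_nhds, hΦ0] at h3
    exact ⟨_, h3.symm⟩

end Reduction

/-! ### The local Darboux theorem by splitting off conjugate pairs -/

section Darboux

universe u

variable {E : Type u} [NormedAddCommGroup E] [NormedSpace ℂ E] [FiniteDimensional ℂ E]

/-- The Hamiltonian vector field of a holomorphic function, as a holomorphic germ. -/
theorem exists_hamiltonianField {B : E → E →L[ℂ] E →L[ℂ] ℂ} (hB : AnalyticAt ℂ B 0)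
    (hnd : ∀ v, (∀ w, B 0 v w = 0) → v = 0) {h : E → ℂ} (hh : AnalyticAt ℂ h 0) :
    ∃ X : E → E, AnalyticAt ℂ X 0 ∧ ∀ᶠ x in 𝓝 0, ∀ w, B x (X x) w = -fderiv ℂ h x w := by
  have := FiniteDimensional.complete ℂ E
  have hinj : Function.Injective (B 0 : E →ₗ[ℂ] E →L[ℂ] ℂ) :=
    (injective_iff_map_eq_zero _).2 fun v hv => hnd v fun w => DFunLike.congr_fun hv w
  have hfin : Module.finrank ℂ E = Module.finrank ℂ (E →L[ℂ] ℂ) :=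
    (Subspace.dual_finrank_eq (K := ℂ) (V := E)).symm.trans
      (LinearMap.toContinuousLinearMap (𝕜 := ℂ) (E := E) (F' := ℂ)).finrank_eq
  let e : E ≃L[ℂ] (E →L[ℂ] ℂ) := (LinearEquiv.ofInjectiveOfFinrankEq
    (B 0 : E →ₗ[ℂ] E →L[ℂ] ℂ) hinj hfin).toContinuousLinearEquiv
  have he : (e : E →L[ℂ] E →L[ℂ] ℂ) = B 0 := by ext; rfl
  -- Inversion of operators is analytic at the isomorphism `B 0`, so the solution of the defining
  -- equation depends analytically on the point.
  have hi : ContDiffAt ℂ ω (ContinuousLinearMap.inverse : (E →L[ℂ] E →L[ℂ] ℂ) → _) (B 0) := by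
    rw [← he]; exact contDiffAt_map_inverse e
  have hBi : ContDiffAt ℂ ω (fun x => (B x).inverse) 0 := hi.comp 0 hB.contDiffAt
  refine ⟨fun x => -(B x).inverse (fderiv ℂ h x),
    ((hBi.clm_apply hh.fderiv.contDiffAt).neg).analyticAt, ?_⟩
  have hn := e.nhds
  rw [he] at hn
  filter_upwards [hB.continuousAt hn] with x hx w
  rw [map_neg, ContinuousLinearMap.IsInvertible.self_apply_inverse hx]
  rfl

/-- A nondegenerate closed form splits off `dh ∧ dg`, for a function `g` conjugate to `h`. -/
theorem exists_split {B : E → E →L[ℂ] E →L[ℂ] ℂ} (hB : IsClosedTwoForm B)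
    (hnd : ∀ v, (∀ w, B 0 v w = 0) → v = 0) {h : E → ℂ} (hh : AnalyticAt ℂ h 0)
    (hh0 : fderiv ℂ h 0 ≠ 0) :
    ∃ (g : E → ℂ) (E₁ : Submodule ℂ E) (E₂ : Submodule ℂ E₁) (π : E → E₂)
      (B₂ : E₂ → E₂ →L[ℂ] E₂ →L[ℂ] ℂ), AnalyticAt ℂ g 0 ∧
      Module.finrank ℂ E₂ + 2 = Module.finrank ℂ E ∧
      IsClosedTwoForm B₂ ∧ (∀ v, (∀ w, B₂ 0 v w = 0) → v = 0) ∧ AnalyticAt ℂ π 0 ∧ π 0 = 0 ∧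
      ∀ᶠ x in 𝓝 0, ∀ a b, B x a b =
        fderiv ℂ h x a * fderiv ℂ g x b - fderiv ℂ g x a * fderiv ℂ h x b +
          B₂ (π x) (fderiv ℂ π x a) (fderiv ℂ π x b) := by
  have := FiniteDimensional.complete ℂ E
  obtain ⟨X, hX, hBX⟩ := exists_hamiltonianField hB.analyticAt hnd hh
  have hX0 : X 0 ≠ 0 := fun h0 => hh0 <| ContinuousLinearMap.ext fun w => by
    have := hBX.self_of_nhds w
    rw [h0] at this
    simpa using this
  -- the conjugate function
  obtain ⟨g, hg, hgX⟩ : ∃ g : E → ℂ, AnalyticAt ℂ g 0 ∧ ∀ᶠ x in 𝓝 0, fderiv ℂ g x (X x) = 1 := by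
    obtain ⟨ℓ, hℓ⟩ := SeparatingDual.exists_eq_one (R := ℂ) hX0
    obtain ⟨Φ, Ψ, hΦ, hΨ, -, -, -, -, -, hΨX⟩ := exists_flowBox hX ℓ hℓ
    -- In flow box coordinates `X` is the constant field `X 0`, so the linear function `ℓ` grows
    -- along it at rate `ℓ (X 0) = 1`.
    refine ⟨fun x => ℓ (Ψ x), (ℓ.analyticAt _).fun_comp hΨ, ?_⟩
    filter_upwards [hΨX, hΨ.eventually_analyticAt] with x h1 h2
    have := HasFDerivAt.comp x (ℓ.hasFDerivAt (x := Ψ x)) h2.differentiableAt.hasFDerivAt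
    refine (DFunLike.congr_fun (HasFDerivAt.fderiv this) (X x)).trans ?_
    rw [ContinuousLinearMap.comp_apply, h1, hℓ]
  obtain ⟨Y, hY, hBY⟩ := exists_hamiltonianField hB.analyticAt hnd hg
  have hpair : ∀ᶠ x in 𝓝 0, fderiv ℂ h x (X x) = 0 ∧ fderiv ℂ g x (Y x) = 0 ∧
      fderiv ℂ h x (Y x) = -1 := by
    filter_upwards [hBX, hBY, hgX] with x h1 h2 h3
    have k1 := hB.alt x (X x) (X x)
    have k2 := hB.alt x (Y x) (Y x)
    have k3 := hB.alt x (X x) (Y x)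
    rw [h1] at k1 k3
    rw [h2] at k2 k3
    rw [h3] at k3
    exact ⟨by linear_combination (-1 / 2 : ℂ) * k1, by linear_combination (-1 / 2 : ℂ) * k2,
      by linear_combination -k3⟩
  let β : E → E →L[ℂ] E →L[ℂ] ℂ := fun x => B x - wedgeForm h g x
  have hβ : IsClosedTwoForm β := hB.sub (isClosedTwoForm_wedgeForm hh hg)
  have hβap : ∀ x a b, β x a b =
      B x a b - (fderiv ℂ h x a * fderiv ℂ g x b - fderiv ℂ g x a * fderiv ℂ h x b) :=
    fun x a b => by rw [← wedgeForm_apply]; rfl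
  have hβX : ∀ᶠ x in 𝓝 0, ∀ b, β x (X x) b = 0 := by
    filter_upwards [hBX, hpair, hgX] with x h1 h2 h3 b
    rw [hβap, h1, h2.1, h3]; ring
  have hβY : ∀ᶠ x in 𝓝 0, ∀ b, β x (Y x) b = 0 := by
    filter_upwards [hBY, hpair] with x h1 h2 b
    rw [hβap, h1, h2.2.1, h2.2.2]; ring
  obtain ⟨E₁, σ₁, π₁, hd₁, hσ₁, hπ₁, hσ₁0, hπ₁0, hπσ₁, hβ₁, hπX, hker⟩ :=
    exists_reduction hβ hX hX0 hβX
  have := FiniteDimensional.complete ℂ E₁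
  have hσ₁c := tendsto_zero_of_analyticAt hσ₁ hσ₁0
  have hπ₁c := tendsto_zero_of_analyticAt hπ₁ hπ₁0
  have hB₁ : IsClosedTwoForm (pullback β σ₁) := hβ.pullback hσ₁ hσ₁0
  -- `Y` is pushed down only along the section `σ₁`, so it need not be projectable or commute with
  -- `X`; the pushed field only has to annihilate the reduced form.
  let W : E₁ → E₁ := fun y => fderiv ℂ π₁ (σ₁ y) (Y (σ₁ y))
  have hW : AnalyticAt ℂ W 0 := by
    have h1 : AnalyticAt ℂ (fun y => fderiv ℂ π₁ (σ₁ y)) 0 :=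
      AnalyticAt.fun_comp (by rw [hσ₁0]; exact hπ₁.fderiv) hσ₁
    have h2 : AnalyticAt ℂ (fun y => Y (σ₁ y)) 0 :=
      AnalyticAt.fun_comp (by rw [hσ₁0]; exact hY) hσ₁
    exact (h1.contDiffAt (n := ω).clm_apply h2.contDiffAt).analyticAt
  have hW0 : W 0 = fderiv ℂ π₁ 0 (Y 0) := by simp only [W, hσ₁0]
  -- The kernel of `dπ₁` at `0` consists of multiples of `X 0`, on which `dh` vanishes, whereas
  -- `dh(Y) = -1`.
  have hWne : W 0 ≠ 0 := fun h0 => by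
    rw [hW0] at h0
    obtain ⟨c, hc⟩ := hker _ h0
    have h1 := hpair.self_of_nhds
    have h2 := h1.2.2
    rw [hc, map_smul, h1.1] at h2
    simp at h2
  have hBW : ∀ᶠ y in 𝓝 0, ∀ b, pullback β σ₁ y (W y) b = 0 := by
    filter_upwards [hσ₁.eventually_analyticAt, hσ₁c.eventually hπ₁.eventually_analyticAt,
      hπσ₁.eventually_nhds, hσ₁c.eventually hβ₁, hσ₁c.eventually hβY] with y h1 h2 h3 h4 h5 b
    have h6 := h4 (Y (σ₁ y)) (fderiv ℂ σ₁ y b)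
    rw [h5, fderiv_comp_eq_id h1 h2 h3, h3.self_of_nhds] at h6
    exact h6.symm
  obtain ⟨E₂, σ₂, π₂, hd₂, hσ₂, hπ₂, hσ₂0, hπ₂0, hπσ₂, hβ₂, hπW, -⟩ :=
    exists_reduction hB₁ hW hWne hBW
  have hDπ : ∀ᶠ x in 𝓝 0, ∀ a, fderiv ℂ (fun x => π₂ (π₁ x)) x a =
      fderiv ℂ π₂ (π₁ x) (fderiv ℂ π₁ x a) := by
    filter_upwards [hπ₁.eventually_analyticAt, hπ₁c.eventually hπ₂.eventually_analyticAt]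
      with x h1 h2 a
    have := HasFDerivAt.comp x h2.differentiableAt.hasFDerivAt h1.differentiableAt.hasFDerivAt
    exact DFunLike.congr_fun (HasFDerivAt.fderiv this) a
  have hfinal : ∀ᶠ x in 𝓝 0, ∀ a b, β x a b =
      pullback (pullback β σ₁) σ₂ (π₂ (π₁ x)) (fderiv ℂ (fun x => π₂ (π₁ x)) x a)
        (fderiv ℂ (fun x => π₂ (π₁ x)) x b) := by
    filter_upwards [hDπ, hβ₁, hπ₁c.eventually hβ₂] with x h1 h2 h3 a b
    rw [h2, h3, h1, h1]
  refine ⟨g, E₁, E₂, fun x => π₂ (π₁ x), pullback (pullback β σ₁) σ₂, hg, by omega,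
    hB₁.pullback hσ₂ hσ₂0, ?_, AnalyticAt.fun_comp (by rw [hπ₁0]; exact hπ₂) hπ₁,
    by simp [hπ₁0, hπ₂0], ?_⟩
  · intro u hu
    have hs₁ : ∀ w, fderiv ℂ π₁ 0 (fderiv ℂ σ₁ 0 w) = w := fun w => by
      have := fderiv_comp_eq_id hσ₁ (by rw [hσ₁0]; exact hπ₁) hπσ₁ w
      rwa [hσ₁0] at this
    have hs₂ : ∀ w, fderiv ℂ π₂ 0 (fderiv ℂ σ₂ 0 w) = w := fun w => by
      have := fderiv_comp_eq_id hσ₂ (by rw [hσ₂0]; exact hπ₂) hπσ₂ w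
      rwa [hσ₂0] at this
    have hD0 := hDπ.self_of_nhds
    rw [hπ₁0] at hD0
    set v := fderiv ℂ σ₁ 0 (fderiv ℂ σ₂ 0 u) with hv
    have huv : fderiv ℂ π₂ 0 (fderiv ℂ π₁ 0 v) = u := by rw [hv, hs₁, hs₂]
    have hβv : ∀ w, β 0 v w = 0 := fun w => by
      rw [hfinal.self_of_nhds, hD0, huv, hπ₁0, hπ₂0]
      exact hu _
    -- A null vector `v` of `β` satisfies `B(v, ·) = dh(v) dg - dg(v) dh`, which is also `B` applied
    -- to this combination of `X` and `Y`. Both fields die in the quotient, so the null vector `u`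
    -- of the reduced form is zero.
    have hvXY : v - (fderiv ℂ g 0 v • X 0 - fderiv ℂ h 0 v • Y 0) = 0 := hnd _ fun w => by
      have h1 := hβv w
      rw [hβap] at h1
      have h2 := hBX.self_of_nhds w
      have h3 := hBY.self_of_nhds w
      simp only [map_sub, map_smul, sub_apply, smul_apply, smul_eq_mul, h2, h3]
      linear_combination h1
    have hX' : fderiv ℂ π₁ 0 (X 0) = 0 := hπX.self_of_nhds
    have hY' : fderiv ℂ π₂ 0 (fderiv ℂ π₁ 0 (Y 0)) = 0 := by
      rw [← hW0]; exact hπW.self_of_nhds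
    rw [← huv, sub_eq_zero.1 hvXY]
    simp [hX', hY']
  · filter_upwards [hfinal] with x hx a b
    rw [← hx, hβap]; ring

/-- The holomorphic Darboux theorem with a prescribed coordinate `h`. -/
theorem exists_darboux_of_fderiv_ne_zero (d : ℕ) : ∀ {E : Type u} [NormedAddCommGroup E]
    [NormedSpace ℂ E] [FiniteDimensional ℂ E] {B : E → E →L[ℂ] E →L[ℂ] ℂ},
    Module.finrank ℂ E = d → IsClosedTwoForm B → (∀ v, (∀ w, B 0 v w = 0) → v = 0) →
    ∀ {h : E → ℂ}, AnalyticAt ℂ h 0 → fderiv ℂ h 0 ≠ 0 →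
    ∃ (n : ℕ) (p q : Fin (n + 1) → E → ℂ), Module.finrank ℂ E = 2 * (n + 1) ∧
      (∀ j, AnalyticAt ℂ (p j) 0) ∧ (∀ j, AnalyticAt ℂ (q j) 0) ∧ p (Fin.last n) = h ∧
      ∀ᶠ x in 𝓝 0, ∀ a b, B x a b =
        ∑ j, (fderiv ℂ (p j) x a * fderiv ℂ (q j) x b -
          fderiv ℂ (q j) x a * fderiv ℂ (p j) x b) := by
  induction d using Nat.strong_induction_on with
  | _ d ih =>
  intro E _ _ _ B hd hB hnd h hh hh0
  obtain ⟨g, E₁, E₂, π, B₂, hg, hd₂, hB₂, hnd₂, hπ, hπ0, hsplit⟩ := exists_split hB hnd hh hh0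
  obtain ⟨n, p', q', hn, hp', hq', hsum⟩ : ∃ (n : ℕ) (p q : Fin n → E₂ → ℂ),
      Module.finrank ℂ E₂ = 2 * n ∧
      (∀ j, AnalyticAt ℂ (p j) 0) ∧ (∀ j, AnalyticAt ℂ (q j) 0) ∧
      ∀ᶠ x in 𝓝 0, ∀ a b, B₂ x a b =
        ∑ j, (fderiv ℂ (p j) x a * fderiv ℂ (q j) x b -
          fderiv ℂ (q j) x a * fderiv ℂ (p j) x b) := by
    rcases subsingleton_or_nontrivial E₂ with hs | hs
    · refine ⟨0, fun _ _ => 0, fun _ _ => 0, by simp [Module.finrank_zero_of_subsingleton],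
        fun j => j.elim0, fun j => j.elim0, Eventually.of_forall fun x a b => ?_⟩
      rw [Subsingleton.elim a 0]; simp
    · obtain ⟨v, hv⟩ := exists_ne (0 : E₂)
      obtain ⟨ℓ, hℓ⟩ := SeparatingDual.exists_eq_one (R := ℂ) hv
      obtain ⟨n, p, q, h1, h2, h3, -, h4⟩ := ih _ (by omega) rfl hB₂ hnd₂ (ℓ.analyticAt 0)
        (fun h0 => by
          rw [ContinuousLinearMap.fderiv] at h0
          rw [h0] at hℓ; simp at hℓ)
      exact ⟨n + 1, p, q, h1, h2, h3, h4⟩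
  have hπc := tendsto_zero_of_analyticAt hπ hπ0
  have hD : ∀ {f : E₂ → ℂ}, AnalyticAt ℂ f 0 → ∀ᶠ x in 𝓝 0, ∀ a,
      fderiv ℂ (fun x => f (π x)) x a = fderiv ℂ f (π x) (fderiv ℂ π x a) := by
    intro f hf
    filter_upwards [hπ.eventually_analyticAt, hπc.eventually hf.eventually_analyticAt]
      with x h1 h2 a
    have := HasFDerivAt.comp x h2.differentiableAt.hasFDerivAt h1.differentiableAt.hasFDerivAt
    exact DFunLike.congr_fun (HasFDerivAt.fderiv this) a
  have hcomp : ∀ {f : E₂ → ℂ}, AnalyticAt ℂ f 0 → AnalyticAt ℂ (fun x => f (π x)) 0 :=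
    fun hf => AnalyticAt.fun_comp (by rw [hπ0]; exact hf) hπ
  refine ⟨n, Fin.snoc (α := fun _ => E → ℂ) (fun j x => p' j (π x)) h,
    Fin.snoc (α := fun _ => E → ℂ) (fun j x => q' j (π x)) g, by omega, ?_, ?_, by simp, ?_⟩
  · refine Fin.lastCases (by simpa using hh) fun j => ?_
    simpa using hcomp (hp' j)
  · refine Fin.lastCases (by simpa using hg) fun j => ?_
    simpa using hcomp (hq' j)
  · filter_upwards [hsplit, hπc.eventually hsum, eventually_all.2 fun j => hD (hp' j),
      eventually_all.2 fun j => hD (hq' j)] with x h1 h2 h3 h4 a b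
    rw [h1, h2, Fin.sum_univ_castSucc]
    simp only [Fin.snoc_castSucc, Fin.snoc_last, h3, h4]
    ring

end Darboux

/-! ### From germs at the origin to forms at any point, and to charts -/

section DarbouxCharts

universe u

variable {E : Type u} [NormedAddCommGroup E] [NormedSpace ℂ E]

/-- A `2`-form as a bilinear map, depending linearly on the form. -/
def curryTwoForm : (E [⋀^Fin 2]→L[ℂ] ℂ) →L[ℂ] E →L[ℂ] E →L[ℂ] ℂ :=
  (ContinuousLinearMap.compL ℂ E (E [⋀^Fin 1]→L[ℂ] ℂ) (E →L[ℂ] ℂ)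
    ((ContinuousAlternatingMap.ofSubsingletonLIE (𝕜 := ℂ) (E := E) (F := ℂ) (0 : Fin 1)).symm :
      (E [⋀^Fin 1]→L[ℂ] ℂ) →L[ℂ] (E →L[ℂ] ℂ))).comp
    (ContinuousAlternatingMap.curryLeftLI (𝕜 := ℂ) (E := E) (F := ℂ) (n := 1)).toContinuousLinearMap

@[simp]
theorem curryTwoForm_apply (f : E [⋀^Fin 2]→L[ℂ] ℂ) (a b : E) :
    curryTwoForm f a b = f ![a, b] := by
  change f (Matrix.vecCons a fun _ => b) = _
  congr 1
  ext i
  fin_cases i <;> rfl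

theorem contDiff_curryTwoForm : ContDiff ℂ ω
    (fun f : E [⋀^Fin 2]→L[ℂ] ℂ => (curryTwoForm f : E →L[ℂ] E →L[ℂ] ℂ)) := by
  fun_prop

theorem analyticAt_curryTwoForm {α : E → E [⋀^Fin 2]→L[ℂ] ℂ} {z : E} (hα : AnalyticAt ℂ α z) :
    AnalyticAt ℂ (fun z => (curryTwoForm (α z) : E →L[ℂ] E →L[ℂ] ℂ)) z :=
  (contDiff_curryTwoForm.contDiffAt.comp z hα.contDiffAt).analyticAt

theorem twoForm_swap (f : E [⋀^Fin 2]→L[ℂ] ℂ) (a b : E) : f ![a, b] = -f ![b, a] := by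
  have h := f.toAlternatingMap.map_swap ![b, a] (i := 0) (j := 1) (by decide)
  have e : ![b, a] ∘ Equiv.swap (0 : Fin 2) 1 = ![a, b] := by
    ext i; fin_cases i <;> simp
  rw [e] at h
  exact h

/-- The exterior derivative is an alternating sum over omitted arguments; swapping the arguments of
its middle term makes it the cyclic sum. -/
theorem isClosedAt_curryTwoForm {α : E → E [⋀^Fin 2]→L[ℂ] ℂ} {z : E}
    (hα : AnalyticAt ℂ α z) (hd : extDeriv α z = 0) :
    IsClosedAt (fun z => curryTwoForm (α z)) z := by
  intro a b c
  have hB := (analyticAt_curryTwoForm hα).differentiableAt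
  simp only [← fderiv_apply_apply hB, curryTwoForm_apply]
  have h := DFunLike.congr_fun hd ![a, b, c]
  rw [extDeriv_apply hα.differentiableAt, Fin.sum_univ_three] at h
  have e0 : (0 : Fin 3).removeNth ![a, b, c] = ![b, c] := by
    ext i; fin_cases i <;> rfl
  have e1 : (1 : Fin 3).removeNth ![a, b, c] = ![a, c] := by
    ext i; fin_cases i <;> rfl
  have e2 : (2 : Fin 3).removeNth ![a, b, c] = ![a, b] := by
    ext i; fin_cases i <;> rfl
  rw [e0, e1, e2] at h
  have e3 : (fun z => α z ![c, a]) = fun z => -α z ![a, c] := funext fun z => twoForm_swap _ _ _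
  rw [e3, fderiv_fun_neg]
  simp at h
  simp
  linear_combination h

/-- The holomorphic Darboux theorem in an open subset of a vector space, with a prescribed
coordinate `h`. -/
theorem exists_darboux_at [FiniteDimensional ℂ E] {α : E → E [⋀^Fin 2]→L[ℂ] ℂ} {z₀ : E}
    (hα : AnalyticAt ℂ α z₀) (hc : ∀ᶠ z in 𝓝 z₀, extDeriv α z = 0)
    (hnd : ∀ v, (∀ w, α z₀ ![v, w] = 0) → v = 0) {h : E → ℂ} (hh : AnalyticAt ℂ h z₀)
    (hh0 : fderiv ℂ h z₀ ≠ 0) :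
    ∃ (n : ℕ) (p q : Fin (n + 1) → E → ℂ), Module.finrank ℂ E = 2 * (n + 1) ∧
      (∀ j, AnalyticAt ℂ (p j) z₀) ∧ (∀ j, AnalyticAt ℂ (q j) z₀) ∧ p (Fin.last n) = h ∧
      ∀ᶠ z in 𝓝 z₀, ∀ a b, α z ![a, b] =
        ∑ j, (fderiv ℂ (p j) z a * fderiv ℂ (q j) z b -
          fderiv ℂ (q j) z a * fderiv ℂ (p j) z b) := by
  let t : E → E := fun z => z + z₀
  have ht0 : t 0 = z₀ := zero_add z₀
  have ht : AnalyticAt ℂ t 0 := by fun_prop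
  have htc : Tendsto t (𝓝 0) (𝓝 z₀) := Continuous.tendsto' (by fun_prop) _ _ ht0
  have hst : Tendsto (fun z => z - z₀) (𝓝 z₀) (𝓝 0) := Continuous.tendsto' (by fun_prop) _ _ (by simp)
  have hB : IsClosedTwoForm (fun z => curryTwoForm (α (t z))) := by
    refine ⟨AnalyticAt.fun_comp (g := fun z => curryTwoForm (α z))
      (by rw [ht0]; exact analyticAt_curryTwoForm hα) ht,
      fun x a b => ?_, ?_⟩
    · simp only [curryTwoForm_apply]; exact twoForm_swap _ _ _
    · filter_upwards [htc.eventually hc, htc.eventually hα.eventually_analyticAt] with z h1 h2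
      have h3 := isClosedAt_curryTwoForm h2 h1
      have h4 : fderiv ℂ (fun z => curryTwoForm (α (t z))) z =
          fderiv ℂ (fun z => curryTwoForm (α z)) (t z) :=
        fderiv_comp_add_right (𝕜 := ℂ) (f := fun z => curryTwoForm (α z)) (x := z) z₀
      unfold IsClosedAt at h3 ⊢
      rwa [h4]
  obtain ⟨n, p, q, hn, hp, hq, hph, hsum⟩ := exists_darboux_of_fderiv_ne_zero _ rfl hB
    (fun v hv => hnd v fun w => by
      have := hv w
      rwa [curryTwoForm_apply, ht0] at this)
    (h := fun z => h (t z)) (AnalyticAt.fun_comp (by rwa [ht0]) ht) (by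
      rwa [fderiv_comp_add_right (f := h), zero_add])
  have hsh : ∀ {f : E → ℂ}, AnalyticAt ℂ f 0 → AnalyticAt ℂ (fun z => f (z - z₀)) z₀ :=
    fun hf => AnalyticAt.fun_comp (by simpa using hf) (by fun_prop)
  refine ⟨n, fun j z => p j (z - z₀), fun j z => q j (z - z₀), hn, fun j => hsh (hp j),
    fun j => hsh (hq j), ?_, ?_⟩
  · funext z
    simp [hph, t]
  · filter_upwards [hst.eventually hsum] with z hz a b
    have := hz a b
    simp only [curryTwoForm_apply, t, sub_add_cancel] at this
    rw [this]
    simp only [fderiv_comp_sub]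

/-- Holomorphic functions with jointly injective differentials at a point are coordinates there. -/
theorem exists_openPartialHomeomorph_of_injective {m : ℕ} {f : Fin m → Cspace m → ℂ}
    {z₀ : Cspace m} (hf : ∀ i, AnalyticAt ℂ (f i) z₀)
    (hinj : ∀ v, (∀ i, fderiv ℂ (f i) z₀ v = 0) → v = 0) {S : Set (Cspace m)} (hS : S ∈ 𝓝 z₀) :
    ∃ k : OpenPartialHomeomorph (Cspace m) (Cspace m), z₀ ∈ k.source ∧ k.source ⊆ S ∧
      k ∈ contDiffGroupoid ω 𝓘(ℂ, Cspace m) ∧ ∀ z i, k z i = f i z := by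
  let ψ : Cspace m → Cspace m := fun z => WithLp.toLp 2 fun i => f i z
  have hψ : ContDiffAt ℂ ω ψ z₀ := contDiffAt_euclidean.2 fun i => (hf i).contDiffAt
  have hψ' : ∀ v i, fderiv ℂ ψ z₀ v i = fderiv ℂ (f i) z₀ v := fun v i => by
    have h1 := (EuclideanSpace.proj (𝕜 := ℂ) i).hasFDerivAt.comp z₀
      (hψ.differentiableAt (by simp)).hasFDerivAt
    exact (DFunLike.congr_fun (HasFDerivAt.fderiv h1) v).symm
  have hinj' : Function.Injective (fderiv ℂ ψ z₀ : Cspace m →ₗ[ℂ] Cspace m) :=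
    (injective_iff_map_eq_zero _).2 fun v hv => hinj v fun i => by
      rw [← hψ']
      exact congrArg (fun u : Cspace m => u i) hv
  let e : Cspace m ≃L[ℂ] Cspace m :=
    (LinearEquiv.ofInjectiveEndo (fderiv ℂ ψ z₀ : Cspace m →ₗ[ℂ] Cspace m) hinj').toContinuousLinearEquiv
  have he : (e : Cspace m →L[ℂ] Cspace m) = fderiv ℂ ψ z₀ := by ext; rfl
  have hd : HasFDerivAt ψ (e : Cspace m →L[ℂ] Cspace m) z₀ := by
    rw [he]; exact (hψ.differentiableAt (by simp)).hasFDerivAt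
  -- The inverse function theorem controls the inverse only near the image of `z₀`; membership in
  -- the groupoid needs an analytic map with invertible derivative on the whole source, hence this
  -- restriction.
  have hgood : ∀ᶠ z in 𝓝 z₀, ContDiffAt ℂ ω ψ z ∧ (∃ e' : Cspace m ≃L[ℂ] Cspace m,
      (e' : Cspace m →L[ℂ] Cspace m) = fderiv ℂ ψ z) ∧ z ∈ S := by
    have hn := e.nhds
    rw [he] at hn
    filter_upwards [hψ.analyticAt.eventually_analyticAt,
      hψ.analyticAt.fderiv.continuousAt hn, hS] with z h1 h2 h3
    exact ⟨h1.contDiffAt, h2, h3⟩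
  obtain ⟨T, hT, hTo, hzT⟩ := eventually_nhds_iff.1 hgood
  let k := (hψ.toOpenPartialHomeomorph ψ hd (by simp)).restrOpen T hTo
  have hsrc : k.source ⊆ T := fun z hz => hz.2
  refine ⟨k, ⟨hψ.mem_toOpenPartialHomeomorph_source hd (by simp), hzT⟩,
    fun z hz => (hT z (hsrc hz)).2.2, ?_, fun z i => rfl⟩
  rw [contDiffGroupoid, mem_groupoid_of_pregroupoid]
  simp only [contDiffPregroupoid, modelWithCornersSelf_coe, modelWithCornersSelf_coe_symm,
    Function.id_comp, Function.comp_id, range_id, inter_univ, preimage_id]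
  refine ⟨fun z hz => (hT z (hsrc hz)).1.contDiffWithinAt, fun y hy => ?_⟩
  have hz := k.map_target hy
  obtain ⟨h1, ⟨e', he'⟩, -⟩ := hT _ (hsrc hz)
  refine (k.contDiffAt_symm (f₀' := e') hy ?_ h1).contDiffWithinAt
  rw [he']
  exact (h1.differentiableAt (by simp)).hasFDerivAt

theorem trans_mem_maximalAtlas {H M : Type*} [TopologicalSpace H] [TopologicalSpace M]
    [ChartedSpace H M] {G : StructureGroupoid H} [HasGroupoid M G]
    {φ : OpenPartialHomeomorph M H} (hφ : φ ∈ G.maximalAtlas M) {k : OpenPartialHomeomorph H H}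
    (hk : k ∈ G) : φ.trans k ∈ G.maximalAtlas M := by
  rw [_root_.mem_maximalAtlas_iff] at hφ ⊢
  intro e he
  refine ⟨?_, ?_⟩
  · rw [OpenPartialHomeomorph.trans_symm_eq_symm_trans_symm, OpenPartialHomeomorph.trans_assoc]
    exact G.trans (G.symm hk) (hφ e he).1
  · rw [← OpenPartialHomeomorph.trans_assoc]
    exact G.trans (hφ e he).2 hk

end DarbouxCharts

/-! ### Poisson brackets in standard form, and Darboux charts on the manifold -/

section Hamiltonian

variable {m : ℕ} {X : Type*} [TopologicalSpace X] [ChartedSpace (Cspace m) X]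

theorem exists_dual_vector {V : Type*} [AddCommGroup V] [Module ℂ V] [TopologicalSpace V]
    [FiniteDimensional ℂ V] {n : ℕ} (hn : Module.finrank ℂ V = 2 * n) (α β : Fin n → V →L[ℂ] ℂ)
    (hinj : ∀ v, (∀ j, α j v = 0) → (∀ j, β j v = 0) → v = 0) (a b : Fin n → ℂ) :
    ∃ v, (∀ j, α j v = a j) ∧ ∀ j, β j v = b j := by
  let L : V →ₗ[ℂ] (Fin n → ℂ) × (Fin n → ℂ) :=
    (LinearMap.pi fun j => (α j : V →ₗ[ℂ] ℂ)).prod (LinearMap.pi fun j => (β j : V →ₗ[ℂ] ℂ))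
  have hL : Function.Injective L := (injective_iff_map_eq_zero _).2 fun v hv =>
    hinj v (fun j => congrFun (congrArg Prod.fst hv) j) fun j => congrFun (congrArg Prod.snd hv) j
  obtain ⟨v, hv⟩ := (LinearMap.injective_iff_surjective_of_finrank_eq_finrank
    (by simp [hn]; omega)).1 hL (a, b)
  exact ⟨v, fun j => congrFun (congrArg Prod.fst hv) j, fun j => congrFun (congrArg Prod.snd hv) j⟩

theorem poisson_eq {Ω : TwoForm m X} (hΩ : IsHolomorphicSymplectic Ω) (F G : X → ℂ) (x : X) :
    poisson Ω F G x = -differential F x (hamVec Ω G x) :=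
  (hamVec_iff hΩ F x _).2 rfl _

/-- The Hamiltonian fields of functions in which `Ω` has the standard form at `x`. -/
theorem differential_hamVec {Ω : TwoForm m X} (hΩ : IsHolomorphicSymplectic Ω) {n : ℕ}
    (hm : m = 2 * n) {F G : Fin n → X → ℂ} {x : X}
    (hform : ∀ v w : TangentSpace 𝓘(ℂ, Cspace m) x, Ω x ![v, w] =
      ∑ j, wedge (differential (m := m) (F j) x) (differential (m := m) (G j) x) v w) (i j : Fin n) :
    differential (F j) x (hamVec Ω (F i) x) = 0 ∧
    differential (G j) x (hamVec Ω (G i) x) = 0 ∧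
    differential (F j) x (hamVec Ω (G i) x) = if i = j then -1 else 0 := by
  have hfd : FiniteDimensional ℂ (TangentSpace 𝓘(ℂ, Cspace m) x) :=
    inferInstanceAs (FiniteDimensional ℂ (Cspace m))
  have hn : Module.finrank ℂ (TangentSpace 𝓘(ℂ, Cspace m) x) = 2 * n :=
    (finrank_euclideanSpace_fin (𝕜 := ℂ) (n := m)).trans hm
  have hdual := exists_dual_vector hn (fun j => differential (m := m) (F j) x)
    (fun j => differential (m := m) (G j) x) (fun v h1 h2 => by
      by_contra hv
      obtain ⟨w, hw⟩ := hΩ.nondegenerate x v hv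
      exact hw (by rw [hform]; simp [wedge, h1, h2]))
  -- Substituting `dF = 0`, `dG = δ` into the standard form gives `-dF_i`, and `dF = -δ`, `dG = 0`
  -- gives `-dG_i`. These are the two Hamiltonian vectors.
  obtain ⟨v, hv1, hv2⟩ := hdual 0 (Pi.single i 1)
  obtain ⟨u, hu1, hu2⟩ := hdual (-Pi.single i 1) 0
  have hv : v = hamVec Ω (F i) x := (hamVec_iff hΩ (F i) x v).1 fun w => by
    rw [hform]
    simp [wedge, hv1, hv2, Pi.single_apply]
  have hu : u = hamVec Ω (G i) x := (hamVec_iff hΩ (G i) x u).1 fun w => by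
    rw [hform]
    simp [wedge, hu1, hu2, Pi.single_apply]
  rw [← hv, ← hu, hv1, hu1, hu2]
  refine ⟨rfl, rfl, ?_⟩
  by_cases h : i = j
  · subst h; simp
  · simp [h, Ne.symm h]

/-- `F` and `G` are commuting functions conjugate to each other where `Ω = ∑ dF_j ∧ dG_j`. -/
theorem poisson_of_standard {Ω : TwoForm m X} (hΩ : IsHolomorphicSymplectic Ω) {n : ℕ}
    (hm : m = 2 * n) {F G : Fin n → X → ℂ} {x : X}
    (hform : ∀ v w : TangentSpace 𝓘(ℂ, Cspace m) x, Ω x ![v, w] =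
      ∑ j, wedge (differential (m := m) (F j) x) (differential (m := m) (G j) x) v w) :
    (∀ i j, poisson Ω (F i) (G j) x = if i = j then 1 else 0) ∧
    (∀ i j, poisson Ω (F i) (F j) x = 0) ∧ (∀ i j, poisson Ω (G i) (G j) x = 0) ∧
    LinearIndependent ℂ fun i => differential (m := m) (F i) x := by
  have h := differential_hamVec hΩ hm hform
  refine ⟨fun i j => ?_, fun i j => ?_, fun i j => ?_, ?_⟩
  · rw [poisson_eq hΩ, (h j i).2.2]
    by_cases hij : i = j
    · simp [hij]
    · simp [hij, Ne.symm hij]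
  · rw [poisson_eq hΩ, (h j i).1, neg_zero]
  · rw [poisson_eq hΩ, (h j i).2.1, neg_zero]
  · refine Fintype.linearIndependent_iff.2 fun c hc k => ?_
    -- Evaluated on the Hamiltonian vector of `G k`, the relation reduces to `-c k = 0`.
    have h1 := DFunLike.congr_fun hc (hamVec Ω (G k) x)
    simpa [sum_apply, (h k _).2.2] using h1

variable [IsManifold 𝓘(ℂ, Cspace m) ω X]

/-- The index of the `j`-th position coordinate among `2n` coordinates. -/
def positionIndex {m n : ℕ} (hm : m = 2 * n) (j : Fin n) : Fin m :=
  Fin.cast (hm.trans (two_mul n)).symm (Fin.castAdd n j)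

/-- The index of the `j`-th momentum coordinate among `2n` coordinates. -/
def momentumIndex {m n : ℕ} (hm : m = 2 * n) (j : Fin n) : Fin m :=
  Fin.cast (hm.trans (two_mul n)).symm (Fin.natAdd n j)

/-- The holomorphic Darboux theorem with a prescribed coordinate `H`. -/
theorem exists_darbouxChart {Ω : TwoForm m X} {H : X → ℂ}
    (hΩH : IsHolomorphicHamiltonianSystem Ω H) {x₀ : X} (hx₀ : differential (m := m) H x₀ ≠ 0) :
    ∃ (n : ℕ) (_ : 0 < n) (hm : m = 2 * n),
      ∃ φ ∈ IsManifold.maximalAtlas 𝓘(ℂ, Cspace m) ω X, x₀ ∈ φ.source ∧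
        (∀ x ∈ φ.source, ∀ v w : TangentSpace 𝓘(ℂ, Cspace m) x,
          Ω x ![v, w] = ∑ j : Fin n,
            wedge (differential (m := m) (fun y => φ y (momentumIndex hm j)) x)
              (differential (m := m) (fun y => φ y (positionIndex hm j)) x) v w) ∧
        (∀ j : Fin n, j.1 + 1 = n → ∀ x ∈ φ.source, H x = φ x (momentumIndex hm j)) := by
  have : IsManifold 𝓘(ℂ, Cspace m) 1 X := IsManifold.of_le (n := ω) le_top
  set φ := chartAt (Cspace m) x₀
  have hφa : φ ∈ atlas (Cspace m) X := chart_mem_atlas _ x₀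
  have hφd : φ.MDifferentiable 𝓘(ℂ, Cspace m) 𝓘(ℂ, Cspace m) := mdifferentiable_chart x₀
  have hxs : x₀ ∈ φ.source := mem_chart_source _ x₀
  set z₀ := φ x₀ with hz₀
  have hz₀t : z₀ ∈ φ.target := φ.map_source hxs
  have htn : φ.target ∈ 𝓝 z₀ := φ.open_target.mem_nhds hz₀t
  -- the form in the chart, evaluated on the images of tangent vectors
  let D : X → Cspace m →L[ℂ] Cspace m := fun x =>
    (mfderiv 𝓘(ℂ, Cspace m) 𝓘(ℂ, Cspace m) φ x :)
  -- Every tangent space is the model space by definition; with a constant codomain the base point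
  -- `φ.symm (φ x)` can be replaced by `x`.
  let Ω' : X → Cspace m [⋀^Fin 2]→L[ℂ] ℂ := Ω
  have hpull : ∀ x ∈ φ.source, ∀ v w : Cspace m,
      Ω' x ![v, w] = Ω.inChart φ (φ x) ![D x v, D x w] := by
    intro x hx v w
    have h1 : ∀ u, mfderiv 𝓘(ℂ, Cspace m) 𝓘(ℂ, Cspace m) φ.symm (φ x) (D x u) = u := fun u =>
      DFunLike.congr_fun (hφd.symm_comp_deriv hx) u
    have h2 : Ω' (φ.symm (φ x)) = Ω' x := congrArg Ω' (φ.left_inv hx)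
    change _ = Ω' (φ.symm (φ x)) _
    rw [h2]
    refine congrArg (Ω' x) ?_
    funext i
    fin_cases i
    · exact (h1 v).symm
    · exact (h1 w).symm
  have hα : AnalyticAt ℂ (Ω.inChart φ) z₀ :=
    ((hΩH.symplectic.holomorphic φ hφa).contDiffAt htn).analyticAt
  have hc : ∀ᶠ z in 𝓝 z₀, extDeriv (Ω.inChart φ) z = 0 := by
    filter_upwards [htn] with z hz using hΩH.symplectic.closed φ hφa z hz
  have hnd : ∀ v, (∀ w, Ω.inChart φ z₀ ![v, w] = 0) → v = 0 := by
    intro v hv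
    obtain ⟨u, hu⟩ : ∃ u, D x₀ u = v := hφd.mfderiv_surjective hxs v
    by_contra hne
    have hu0 : u ≠ 0 := fun h0 => hne (by rw [← hu, h0, map_zero])
    obtain ⟨w, hw⟩ := hΩH.symplectic.nondegenerate x₀ u hu0
    refine hw ((hpull x₀ hxs u w).trans ?_)
    rw [hu]
    exact hv _
  let h : Cspace m → ℂ := fun z => H (φ.symm z)
  have hh : AnalyticAt ℂ h z₀ := by
    have h1 : ContMDiffAt 𝓘(ℂ, Cspace m) 𝓘(ℂ, Cspace m) ω φ.symm z₀ :=
      (contMDiffOn_chart_symm (n := ω) (x := x₀)).contMDiffAt htn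
    have h2 := ContMDiffAt.comp z₀ (hΩH.hamiltonian (φ.symm z₀)) h1
    exact (contMDiffAt_iff_contDiffAt.1 h2).analyticAt
  -- differentials of functions given in the chart
  have hdiff : ∀ x ∈ φ.source, ∀ f : Cspace m → ℂ, DifferentiableAt ℂ f (φ x) →
      ∀ v, differential (m := m) (fun y => f (φ y)) x v =
        fderiv ℂ f (φ x) (D x v) := by
    intro x hx f hf v
    have h1 := mfderiv_comp x (I := 𝓘(ℂ, Cspace m)) (I' := 𝓘(ℂ, Cspace m)) (I'' := 𝓘(ℂ, ℂ))
      hf.mdifferentiableAt (hφd.mdifferentiableAt hx)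
    rw [mfderiv_eq_fderiv] at h1
    exact DFunLike.congr_fun h1 v
  have hh0 : fderiv ℂ h z₀ ≠ 0 := by
    intro h0
    refine hx₀ (ContinuousLinearMap.ext fun v => ?_)
    have h1 : H =ᶠ[𝓝 x₀] fun y => h (φ y) := by
      filter_upwards [φ.open_source.mem_nhds hxs] with y hy
      simp only [h, φ.left_inv hy]
    have h2 := hdiff x₀ hxs h hh.differentiableAt v
    rw [← hz₀, h0] at h2
    have h3 : differential (m := m) H x₀ = differential (m := m) (fun y => h (φ y)) x₀ :=
      h1.mfderiv_eq
    rw [h3]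
    exact h2
  obtain ⟨n, p, q, hn, hp, hq, hph, hsum⟩ := exists_darboux_at hα hc hnd hh hh0
  rw [finrank_euclideanSpace_fin] at hn
  -- Positions `q` come first and momenta `p` last, so that `p (Fin.last n) = h` is the final
  -- coordinate.
  let f : Fin m → Cspace m → ℂ := fun i =>
    if hi : i.1 < n + 1 then q ⟨i, hi⟩ else p ⟨i - (n + 1), by omega⟩
  have hfq : ∀ j, f (positionIndex hn j) = q j := fun j => dif_pos j.2
  have hfp : ∀ j, f (momentumIndex hn j) = p j := fun j => by
    simp only [f, momentumIndex, Fin.val_cast, Fin.val_natAdd]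
    rw [dif_neg (by omega)]
    congr 1
    ext
    simp
  have hf : ∀ i, AnalyticAt ℂ (f i) z₀ := fun i => by
    simp only [f]
    split_ifs
    · exact hq _
    · exact hp _
  -- A vector killed by all these differentials is null for the form in standard shape, hence zero.
  have hinj : ∀ v, (∀ i, fderiv ℂ (f i) z₀ v = 0) → v = 0 := fun v hv => hnd v fun w => by
    rw [hsum.self_of_nhds]
    refine Finset.sum_eq_zero fun j _ => ?_
    have h1 := hv (positionIndex hn j)
    have h2 := hv (momentumIndex hn j)
    rw [hfq] at h1
    rw [hfp] at h2
    rw [h1, h2]; ring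
  obtain ⟨k, hk₀, hkS, hkG, hkf⟩ := exists_openPartialHomeomorph_of_injective hf hinj
    (S := {z | (∀ a b, Ω.inChart φ z ![a, b] =
        ∑ j, (fderiv ℂ (p j) z a * fderiv ℂ (q j) z b -
          fderiv ℂ (q j) z a * fderiv ℂ (p j) z b)) ∧
        (∀ j, AnalyticAt ℂ (p j) z) ∧ ∀ j, AnalyticAt ℂ (q j) z})
    (hsum.and ((eventually_all.2 fun j => (hp j).eventually_analyticAt).and
      (eventually_all.2 fun j => (hq j).eventually_analyticAt)))
  refine ⟨n + 1, n.succ_pos, hn, φ.trans k,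
    trans_mem_maximalAtlas (IsManifold.subset_maximalAtlas hφa) hkG, ?_, ?_, ?_⟩
  · rw [OpenPartialHomeomorph.trans_source]
    exact ⟨hxs, hk₀⟩
  · intro x hx v w
    rw [OpenPartialHomeomorph.trans_source] at hx
    obtain ⟨h1, h2, h3⟩ := hkS hx.2
    refine (hpull x hx.1 v w).trans ((h1 _ _).trans (Finset.sum_congr rfl fun j _ => ?_))
    have e1 : (fun y => (φ.trans k) y (momentumIndex hn j)) = fun y => p j (φ y) := by
      funext y
      rw [OpenPartialHomeomorph.coe_trans, Function.comp_apply, hkf, hfp]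
    have e2 : (fun y => (φ.trans k) y (positionIndex hn j)) = fun y => q j (φ y) := by
      funext y
      rw [OpenPartialHomeomorph.coe_trans, Function.comp_apply, hkf, hfq]
    rw [e1, e2, wedge, hdiff x hx.1 _ (h2 j).differentiableAt,
      hdiff x hx.1 _ (h2 j).differentiableAt, hdiff x hx.1 _ (h3 j).differentiableAt,
      hdiff x hx.1 _ (h3 j).differentiableAt]
    ring
  · intro j hj x hx
    rw [OpenPartialHomeomorph.trans_source] at hx
    obtain rfl : j = Fin.last n := Fin.ext (Nat.succ_injective hj)
    rw [OpenPartialHomeomorph.coe_trans, Function.comp_apply, hkf, hfp, hph]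
    simp only [h, φ.left_inv hx.1]

omit [IsManifold 𝓘(ℂ, Cspace m) ω X] in
theorem isHolomorphicOn_coordinate {φ : OpenPartialHomeomorph X (Cspace m)}
    (hφ : φ ∈ IsManifold.maximalAtlas 𝓘(ℂ, Cspace m) ω X) (i : Fin m) :
    IsHolomorphicOn (m := m) (fun y => φ y i) φ.source := by
  have h1 := contMDiffOn_of_mem_maximalAtlas hφ
  exact ((EuclideanSpace.proj (𝕜 := ℂ) i).contMDiff (n := ω)).comp_contMDiffOn h1

end Hamiltonian

end HolHam

end

/-! ### Normal form, conjugate functions and integrability from one Darboux chart -/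

theorem mainTheorem9 {m : ℕ} {X : Type*} [TopologicalSpace X]
    [ChartedSpace (HolHam.Cspace m) X] [IsManifold 𝓘(ℂ, HolHam.Cspace m) ω X]
    (Ω : HolHam.TwoForm m X) (H : X → ℂ)
    (hΩH : HolHam.IsHolomorphicHamiltonianSystem Ω H) :
    (∀ x₀ : X, HolHam.differential (m := m) H x₀ ≠ 0 →
      ∃ (n : ℕ) (hn : 0 < n) (hm : m = 2 * n),
        -- the standard form in a holomorphic chart `φ = (z_1, …, z_{2n})` near `x₀`
        (∃ φ ∈ IsManifold.maximalAtlas 𝓘(ℂ, HolHam.Cspace m) ω X, x₀ ∈ φ.source ∧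
          (∀ x ∈ φ.source, ∀ v w : TangentSpace 𝓘(ℂ, HolHam.Cspace m) x,
            Ω x ![v, w] = ∑ j : Fin n,
              HolHam.wedge
                (HolHam.differential (m := m) (fun y => φ y ⟨n + j, by omega⟩) x)
                (HolHam.differential (m := m) (fun y => φ y ⟨j, by omega⟩) x) v w) ∧
          (∀ x ∈ φ.source, H x = φ x ⟨2 * n - 1, by omega⟩)) ∧
        -- commuting functions and their conjugates near `x₀`
        (∃ (U : Set X) (F G : Fin n → X → ℂ), IsOpen U ∧ x₀ ∈ U ∧
          (∀ i, HolHam.IsHolomorphicOn (m := m) (F i) U) ∧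
          (∀ i, HolHam.IsHolomorphicOn (m := m) (G i) U) ∧
          Set.EqOn (F ⟨n - 1, by omega⟩) H U ∧
          (∀ x ∈ U, ∀ i j, HolHam.poisson Ω (F i) (G j) x = if i = j then 1 else 0) ∧
          (∀ x ∈ U, ∀ i j, HolHam.poisson Ω (F i) (F j) x = 0) ∧
          (∀ x ∈ U, ∀ i j, HolHam.poisson Ω (G i) (G j) x = 0))) ∧
    -- every regular system is locally integrable
    (HolHam.IsRegular (m := m) H → HolHam.IsLocallyIntegrable Ω H) := by
  have hΩ := hΩH.symplectic
  refine ⟨fun x₀ hx₀ => ?_, fun hreg x₀ => ?_⟩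
  · obtain ⟨n, hn, hm, φ, hφ, hx, hform, hH⟩ := HolHam.exists_darbouxChart hΩH hx₀
    have hst := fun x hx => HolHam.poisson_of_standard hΩ hm
      (F := fun j y => φ y (HolHam.momentumIndex hm j))
      (G := fun j y => φ y (HolHam.positionIndex hm j)) (hform x hx)
    -- The momenta serve as `F` and the positions as `G`, matching `dz_{j+n} ∧ dz_j`; indices start
    -- at `0`, so `z_{2n}` has index `2 * n - 1`.
    refine ⟨n, hn, hm, ⟨φ, hφ, hx, hform, fun x hx => ?_⟩, φ.source,
      fun j y => φ y (HolHam.momentumIndex hm j), fun j y => φ y (HolHam.positionIndex hm j),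
      φ.open_source, hx, fun j => HolHam.isHolomorphicOn_coordinate hφ _,
      fun j => HolHam.isHolomorphicOn_coordinate hφ _,
      fun x hx => (hH _ (Nat.sub_add_cancel hn) x hx).symm,
      fun x hx => (hst x hx).1, fun x hx => (hst x hx).2.1, fun x hx => (hst x hx).2.2.1⟩
    refine (hH ⟨n - 1, Nat.sub_lt hn one_pos⟩ (Nat.sub_add_cancel hn) x hx).trans ?_
    exact congrArg (fun i => φ x i) (Fin.ext (show n + (n - 1) = 2 * n - 1 by omega))
  · obtain ⟨n, hn, hm, φ, hφ, hx, hform, hH⟩ := HolHam.exists_darbouxChart hΩH (hreg x₀)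
    have hst := fun x hx => HolHam.poisson_of_standard hΩ hm
      (F := fun j y => φ y (HolHam.momentumIndex hm j))
      (G := fun j y => φ y (HolHam.positionIndex hm j)) (hform x hx)
    exact ⟨n, hn, hm, φ.source, fun j y => φ y (HolHam.momentumIndex hm j), φ.open_source, hx,
      fun j => HolHam.isHolomorphicOn_coordinate hφ _,
      fun x hx => (hH _ (Nat.sub_add_cancel hn) x hx).symm,
      fun x hx => (hst x hx).2.1, fun x hx => (hst x hx).2.2.2⟩
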